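/- A circle means an oriented generalized circle in $\hat{\mathbb C}=\mathbb C\cup\{\infty\}$ (a circle or a line, with one of its two complementary regions chosen as the interior). $\mathrm{M\ddot ob}$ is the group of holomorphic and antiholomorphic Möbius transformations of $\hat{\mathbb C}$, acting on oriented circles, and $\sigma_c\in\mathrm{M\ddot ob}$ is the reflection across $c$. The tangency graph $G_F$ of a collection $F$ of circles has the circles of $F$ as vertices and the tangent pairs as edges; it is drawn in $\hat{\mathbb C}$ by placing each vertex in the interior of its circle and drawing each edge through the point of tangency. A collection of circles accumulates at $x\in\hat{\mathbb C}$ if every open neighbourhood of $x$ contains infinitely many of the circles. Let $B$ and $\hat B$ be a base configuration and a dual configuration, that is, collections of circles such that: (1) the circles in $B$ are pairwise disjoint or tangent, with disjoint interiors, and the same holds for $\hat B$; (2) $G_B$ and $G_{\hat B}$ are nontrivial and connected, and are dual to each other as embedded graphs (an edge through the accumulation point, if there is one, takes no part in the duality); (3) if a circle of $B$ and a circle of $\hat B$ intersect, they do so orthogonally and they correspond to a face-vertex pair of the tangency graphs; otherwise their interiors are disjoint; (4) $B\cup\hat B$ has at most one accumulation point. Let $\Gamma_1=\langle\sigma_d: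 d\in\hat B\rangle$ and $\hat\Gamma_1=\langle\sigma_c: c\in B\rangle$, and let $\Gamma_2$ be the group of Möbius transformations that preserve both $B$ and $\hat B$. Let the superpacking $\mathscr S$ and the dual superpacking $\hat{\mathscr S}$ be the orbits of $B$ and of $\hat B$ under $\langle\Gamma_1,\hat\Gamma_1\rangle$, and let $\Gamma_{\mathscr S}$ be the group of Möbius transformations that preserve both $\mathscr S$ and $\hat{\mathscr S}$. **Theorem.** $\Gamma_{\mathscr S}\cong\langle\Gamma_1,\hat\Gamma_1\rangle\rtimes\Gamma_2$. More precisely, $\Gamma_2$ acts on $\langle\Gamma_1,\hat\Gamma_1\rangle$ by conjugation, and $(n,h)\mapsto nh$ is a group isomorphism from the corresponding semidirect product $\langle\Gamma_1,\hat\Gamma_1\rangle\rtimes\Gamma_2$ onto $\Gamma_{\mathscr S}$. -/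

import Mathlib

open Set OnePoint
open scoped Pointwise ComplexConjugate

noncomputable section

namespace CirclePacking

/-- The extended complex plane. -/
abbrev RiemannSphere : Type := OnePoint ℂ

/-! ### Möbius transformations -/

/-- Complex conjugation on the extended complex plane (it fixes `∞`). -/
def conjPerm : Equiv.Perm RiemannSphere where
  toFun := OnePoint.map (starRingEnd ℂ)
  invFun := OnePoint.map (starRingEnd ℂ)
  left_inv z := by cases z using OnePoint.rec <;> simp
  right_inv z := by cases z using OnePoint.rec <;> simp

/-- The holomorphic Möbius transformation `z ↦ (p z + q) / (r z + s)`. -/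
def holPerm : GL (Fin 2) ℂ →* Equiv.Perm RiemannSphere :=
  MulAction.toPermHom (GL (Fin 2) ℂ) RiemannSphere

lemma conjPerm_mul_self : conjPerm * conjPerm = 1 := by
  ext1 z
  cases z using OnePoint.rec <;> simp [conjPerm]

lemma conjPerm_mul_holPerm (M : GL (Fin 2) ℂ) :
    conjPerm * holPerm M = holPerm (M.map (starRingEnd ℂ)) * conjPerm := by
  ext1 z
  exact OnePoint.map_smul (starRingEnd ℂ) M z

/-- The group of holomorphic and antiholomorphic Möbius transformations of the extended plane. -/
def Moebius : Subgroup (Equiv.Perm RiemannSphere) where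
  carrier := {f | ∃ M : GL (Fin 2) ℂ, f = holPerm M ∨ f = holPerm M * conjPerm}
  one_mem' := ⟨1, Or.inl (by simp)⟩
  mul_mem' := by
    rintro f g ⟨M, rfl | rfl⟩ ⟨N, rfl | rfl⟩
    · exact ⟨M * N, Or.inl (by simp)⟩
    · exact ⟨M * N, Or.inr (by simp [mul_assoc])⟩
    · exact ⟨M * N.map (starRingEnd ℂ), Or.inr (by
        rw [mul_assoc, conjPerm_mul_holPerm, map_mul, mul_assoc])⟩
    · exact ⟨M * N.map (starRingEnd ℂ), Or.inl (by
        rw [mul_assoc, ← mul_assoc conjPerm, conjPerm_mul_holPerm, mul_assoc,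
          conjPerm_mul_self, map_mul, mul_one])⟩
  inv_mem' := by
    rintro f ⟨M, rfl | rfl⟩
    · exact ⟨M⁻¹, Or.inl (by simp)⟩
    · refine ⟨M⁻¹.map (starRingEnd ℂ), Or.inr ?_⟩
      rw [← conjPerm_mul_holPerm, mul_inv_rev, map_inv,
        inv_eq_of_mul_eq_one_left conjPerm_mul_self]

/-! ### Oriented generalized circles -/

/-- The Hermitian form `a |x|² - 2 Re (conj b · x · conj y) + d |y|²`. -/
def hermForm (a : ℝ) (b : ℂ) (d : ℝ) (x y : ℂ) : ℝ :=
  a * Complex.normSq x - 2 * (conj b * x * conj y).re + d * Complex.normSq y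

/-- The left-hand side of the equation `a |z|² - 2 Re (conj b · z) + d = 0` of a generalized
circle; at `∞` the sign of this expression is that of the leading coefficient `a`. -/
def circleForm (a : ℝ) (b : ℂ) (d : ℝ) : RiemannSphere → ℝ
  | ∞ => hermForm a b d 1 0
  | (z : ℂ) => hermForm a b d z 1

/-- `a |z|² - 2 Re (conj b · z) + d = 0` is an equation of a generalized circle with curve `C`
such that the left-hand side is negative exactly on `I`. For `a > 0` these are the circle and the
disc with centre `b / a`, for `a < 0` the interior is the outside of the circle, including `∞`, and
for `a = 0` the curve is a line, including `∞`, and the interior is an open half-plane. -/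
def IsEquationOf (a : ℝ) (b : ℂ) (d : ℝ) (C I : Set RiemannSphere) : Prop :=
  0 < Complex.normSq b - a * d ∧
    C = {z | circleForm a b d z = 0} ∧ I = {z | circleForm a b d z < 0}

/-- An oriented generalized circle: a circle or line in the extended plane, with the choice of one
of its two complementary regions as the interior. -/
@[ext]
structure OrientedCircle where
  curve : Set RiemannSphere
  interior : Set RiemannSphere
  exists_equation : ∃ a b d, IsEquationOf a b d curve interior

lemma hermForm_homogeneous (a : ℝ) (b : ℂ) (d : ℝ) (u x y : ℂ) :
    hermForm a b d (x * u) (y * u) = Complex.normSq u * hermForm a b d x y := by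
  simp only [hermForm, Complex.normSq_apply, Complex.mul_re, Complex.mul_im, Complex.conj_re,
    Complex.conj_im]
  ring

lemma hermForm_transform (p q r s : ℂ) (a : ℝ) (b : ℂ) (d : ℝ) :
    ∃ (a' : ℝ) (b' : ℂ) (d' : ℝ),
      Complex.normSq b' - a' * d' =
        Complex.normSq (p * s - q * r) * (Complex.normSq b - a * d) ∧
      ∀ x y, hermForm a' b' d' (p * x + q * y) (r * x + s * y) =
        Complex.normSq (p * s - q * r) * hermForm a b d x y := by
  refine ⟨a * Complex.normSq s + 2 * (conj b * s * conj r).re + d * Complex.normSq r,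
    a * conj s * q + b * conj s * p + conj b * q * conj r + d * conj r * p,
    a * Complex.normSq q + 2 * (conj b * q * conj p).re + d * Complex.normSq p, ?_, ?_⟩
  · simp only [Complex.normSq_apply, Complex.mul_re, Complex.mul_im, Complex.conj_re,
      Complex.conj_im, Complex.add_re, Complex.add_im, Complex.sub_re, Complex.sub_im,
      Complex.ofReal_re, Complex.ofReal_im]
    ring
  · intro x y
    simp only [hermForm, Complex.normSq_apply, Complex.mul_re, Complex.mul_im, Complex.conj_re,
      Complex.conj_im, Complex.add_re, Complex.add_im, Complex.sub_re, Complex.sub_im,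
      Complex.ofReal_re, Complex.ofReal_im]
    ring

lemma exists_circleForm_holPerm (M : GL (Fin 2) ℂ) (a : ℝ) (b : ℂ) (d : ℝ)
    (h : 0 < Complex.normSq b - a * d) :
    ∃ (a' : ℝ) (b' : ℂ) (d' : ℝ), 0 < Complex.normSq b' - a' * d' ∧
      ∀ z, ∃ k : ℝ, 0 < k ∧ circleForm a' b' d' (holPerm M z) = k * circleForm a b d z := by
  have hdet : M 0 0 * M 1 1 - M 0 1 * M 1 0 ≠ 0 := by
    simpa [Matrix.det_fin_two] using M.det_ne_zero
  obtain ⟨a', b', d', h1, h2⟩ := hermForm_transform (M 0 0) (M 0 1) (M 1 0) (M 1 1) a b d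
  have hD := Complex.normSq_pos.2 hdet
  refine ⟨a', b', d', h1 ▸ mul_pos hD h, ?_⟩
  -- a point with homogeneous coordinates `(x, y)` is sent to `(X, Y)`
  have key : ∀ x y X Y : ℂ, X = M 0 0 * x + M 0 1 * y → Y = M 1 0 * x + M 1 1 * y →
      (x ≠ 0 ∨ y ≠ 0) →
      ∃ k : ℝ, 0 < k ∧
        (if Y = 0 then hermForm a' b' d' 1 0 else hermForm a' b' d' (X / Y) 1)
          = k * hermForm a b d x y := by
    intro x y X Y hX hY hxy
    have h3 := h2 x y
    rw [← hX, ← hY] at h3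
    split_ifs with hY0
    · have hX0 : X ≠ 0 := by
        intro hX0
        have e1 : (M 0 0 * M 1 1 - M 0 1 * M 1 0) * x = 0 := by
          linear_combination (-M 1 1) * hX + M 0 1 * hY + M 1 1 * hX0 - M 0 1 * hY0
        have e2 : (M 0 0 * M 1 1 - M 0 1 * M 1 0) * y = 0 := by
          linear_combination (M 1 0) * hX - M 0 0 * hY - M 1 0 * hX0 + M 0 0 * hY0
        rcases hxy with hx | hy
        · exact (mul_ne_zero hdet hx) e1
        · exact (mul_ne_zero hdet hy) e2
      have hXp := Complex.normSq_pos.2 hX0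
      refine ⟨Complex.normSq (M 0 0 * M 1 1 - M 0 1 * M 1 0) / Complex.normSq X,
        div_pos hD hXp, ?_⟩
      have h4 := hermForm_homogeneous a' b' d' X 1 0
      rw [one_mul, zero_mul] at h4
      rw [hY0, h4] at h3
      rw [div_mul_eq_mul_div, ← h3]
      field_simp
    · have hYp := Complex.normSq_pos.2 hY0
      refine ⟨Complex.normSq (M 0 0 * M 1 1 - M 0 1 * M 1 0) / Complex.normSq Y,
        div_pos hD hYp, ?_⟩
      have h4 := hermForm_homogeneous a' b' d' Y (X / Y) 1
      rw [one_mul, div_mul_cancel₀ _ hY0] at h4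
      rw [h4] at h3
      rw [div_mul_eq_mul_div, ← h3]
      field_simp
  intro z
  cases z using OnePoint.rec with
  | infty =>
    obtain ⟨k, hk, e⟩ := key 1 0 (M 0 0) (M 1 0) (by simp) (by simp) (Or.inl one_ne_zero)
    refine ⟨k, hk, ?_⟩
    change circleForm a' b' d' (M • (∞ : OnePoint ℂ)) = k * hermForm a b d 1 0
    rw [← e, smul_infty_eq_ite]
    split_ifs <;> rfl
  | coe z =>
    obtain ⟨k, hk, e⟩ := key z 1 (M 0 0 * z + M 0 1) (M 1 0 * z + M 1 1) (by simp) (by simp)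
      (Or.inr one_ne_zero)
    refine ⟨k, hk, ?_⟩
    change circleForm a' b' d' (M • (z : OnePoint ℂ)) = k * hermForm a b d z 1
    rw [← e, smul_some_eq_ite]
    split_ifs <;> rfl

lemma circleForm_conjPerm (a : ℝ) (b : ℂ) (d : ℝ) (z : RiemannSphere) :
    circleForm a (conj b) d (conjPerm z) = circleForm a b d z := by
  cases z using OnePoint.rec with
  | infty => change hermForm _ _ _ 1 0 = hermForm _ _ _ 1 0; simp [hermForm]
  | coe z => change hermForm _ _ _ (conj z) 1 = hermForm _ _ _ z 1; simp [hermForm]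

lemma exists_circleForm_moebius (f : Moebius) (a : ℝ) (b : ℂ) (d : ℝ)
    (h : 0 < Complex.normSq b - a * d) :
    ∃ (a' : ℝ) (b' : ℂ) (d' : ℝ), 0 < Complex.normSq b' - a' * d' ∧
      ∀ z, ∃ k : ℝ, 0 < k ∧ circleForm a' b' d' (f.1 z) = k * circleForm a b d z := by
  obtain ⟨f, M, rfl | rfl⟩ := f
  · exact exists_circleForm_holPerm M a b d h
  · obtain ⟨a', b', d', h1, h2⟩ := exists_circleForm_holPerm M a (conj b) d (by simpa using h)
    refine ⟨a', b', d', h1, fun z => ?_⟩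
    obtain ⟨k, hk, e⟩ := h2 (conjPerm z)
    exact ⟨k, hk, by rw [← circleForm_conjPerm a b d z]; exact e⟩

/-- Möbius transformations act on oriented generalized circles by taking images of the curve and
of the interior. -/
instance : MulAction Moebius OrientedCircle where
  smul f c :=
    { curve := f • c.curve
      interior := f • c.interior
      exists_equation := by
        obtain ⟨a, b, d, h, hC, hI⟩ := c.exists_equation
        obtain ⟨a', b', d', h', hz⟩ := exists_circleForm_moebius f a b d h
        have hz' : ∀ z : RiemannSphere, ∃ k : ℝ, 0 < k ∧
            circleForm a' b' d' z = k * circleForm a b d (f⁻¹ • z) := fun z => by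
          obtain ⟨k, hk, e⟩ := hz (f⁻¹ • z)
          exact ⟨k, hk, by rw [← e]; exact congrArg _ (smul_inv_smul f z).symm⟩
        refine ⟨a', b', d', h', ?_, ?_⟩
        · ext z
          obtain ⟨k, hk, e⟩ := hz' z
          rw [Set.mem_smul_set_iff_inv_smul_mem, hC, mem_ofPred_eq, mem_ofPred_eq, e]
          simp [hk.ne']
        · ext z
          obtain ⟨k, hk, e⟩ := hz' z
          rw [Set.mem_smul_set_iff_inv_smul_mem, hI, mem_ofPred_eq, mem_ofPred_eq, e]
          simp [mul_neg_iff, hk, hk.le, not_lt.2] }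
  one_smul c := OrientedCircle.ext (one_smul Moebius c.curve) (one_smul Moebius c.interior)
  mul_smul f g c :=
    OrientedCircle.ext (mul_smul f g c.curve) (mul_smul f g c.interior)

/-- The antiholomorphic map `z ↦ (b · conj z - d) / (a · conj z - conj b)`, which is the reflection
across the generalized circle `a |z|² - 2 Re (conj b · z) + d = 0`. -/
def reflectionOfEquation (a : ℝ) (b : ℂ) (d : ℝ) (h : 0 < Complex.normSq b - a * d) : Moebius :=
  ⟨holPerm (Matrix.GeneralLinearGroup.mkOfDetNeZero !![b, -(d : ℂ); (a : ℂ), -conj b] (by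
      rw [Matrix.det_fin_two_of]
      have e : b * -conj b - -(d : ℂ) * a = ((-(Complex.normSq b - a * d) : ℝ) : ℂ) := by
        push_cast
        rw [← Complex.mul_conj]
        ring
      rw [e]
      exact_mod_cast (neg_lt_zero.2 h).ne)) * conjPerm,
    ⟨_, Or.inr rfl⟩⟩

/-- The reflection `σ_c` across `c`. (The equation of `c` is unique up to a positive factor, which
does not affect the reflection.) -/
def reflection (c : OrientedCircle) : Moebius :=
  reflectionOfEquation c.exists_equation.choose c.exists_equation.choose_spec.choose
    c.exists_equation.choose_spec.choose_spec.choose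
    c.exists_equation.choose_spec.choose_spec.choose_spec.1

/-- The circles do not meet. -/
def OrientedCircle.IsDisjointFrom (c c' : OrientedCircle) : Prop := c.curve ∩ c'.curve = ∅

/-- The circles meet in exactly one point, the point of tangency (parallel lines are tangent
at `∞`). -/
def OrientedCircle.IsTangentTo (c c' : OrientedCircle) : Prop := ∃ x, c.curve ∩ c'.curve = {x}

/-- The circles meet at right angles. For circles with centres `p`, `p'` and radii `r`, `r'` the
equation says `|p - p'|² = r² + r'²`. -/
def OrientedCircle.IsOrthogonalTo (c c' : OrientedCircle) : Prop :=
  ∃ a b d a' b' d', IsEquationOf a b d c.curve c.interior ∧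
    IsEquationOf a' b' d' c'.curve c'.interior ∧
    2 * (b * conj b').re - a * d' - a' * d = 0

/-- The unit circle, with the open unit disc as its interior. -/
def unitCircle : OrientedCircle where
  curve := {z | circleForm 1 0 (-1) z = 0}
  interior := {z | circleForm 1 0 (-1) z < 0}
  exists_equation := ⟨1, 0, -1, by simp, rfl, rfl⟩

/-! ### Tangency graphs and their planar embedding -/

/-- The tangency graph `G_B`. -/
def tangencyGraph (B : Set OrientedCircle) : SimpleGraph B where
  Adj c c' := c ≠ c' ∧ c.1.IsTangentTo c'.1
  symm := ⟨fun _ _ h => ⟨h.1.symm, by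
    obtain ⟨x, hx⟩ := h.2
    exact ⟨x, by rw [inter_comm, hx]⟩⟩⟩
  loopless := ⟨fun _ h => h.1 rfl⟩

/-- The collection `F` accumulates at `x`: every open neighbourhood of `x` contains infinitely
many circles of `F`. -/
def AccumulatesAt (F : Set OrientedCircle) (x : RiemannSphere) : Prop :=
  ∀ U : Set RiemannSphere, IsOpen U → x ∈ U → {c ∈ F | c.curve ⊆ U}.Infinite

/-- The edges of `G_B` whose point of tangency is not an accumulation point of `F`. -/
def regularEdges (B F : Set OrientedCircle) : Set (Sym2 B) :=
  {e ∈ (tangencyGraph B).edgeSet | ∀ x, (∀ c ∈ e, x ∈ c.1.curve) → ¬ AccumulatesAt F x}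

/-- A choice, for each oriented circle, of a Möbius transformation from the unit disc onto its
interior. The image of `0` serves as the vertex of the circle, and the images of the radii of
the unit disc serve as the halves of edges. (For an affine map these are the centre and
the radii of a circle.) -/
structure DiscParametrization where
  toMoebius : OrientedCircle → Moebius
  smul_unitCircle : ∀ c, toMoebius c • unitCircle = c

namespace DiscParametrization

variable (g : DiscParametrization)

/-- The point of the interior of `c` at which the vertex `c` is placed. -/
def vertex (c : OrientedCircle) : RiemannSphere := g.toMoebius c • ((0 : ℂ) : RiemannSphere)

/-- The arc in `c` from its vertex to the point `x` of its curve. -/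
def halfEdge (c : OrientedCircle) (x : RiemannSphere) : Set RiemannSphere :=
  {z | ∃ ζ : ℂ, g.toMoebius c • (ζ : RiemannSphere) = x ∧
    ∃ t ∈ Icc (0 : ℝ) 1, z = g.toMoebius c • (((t : ℂ) * ζ : ℂ) : RiemannSphere)}

/-- The arc representing an edge: it joins the two vertices through the point of tangency. -/
def edgeArc {B : Set OrientedCircle} (e : Sym2 B) : Set RiemannSphere :=
  {z | ∃ x, (∀ c ∈ e, x ∈ c.1.curve) ∧ ∃ c ∈ e, z ∈ g.halfEdge c.1 x}

/-- The embedded graph `G_B`: all vertices and all edges. -/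
def realization (B : Set OrientedCircle) : Set RiemannSphere :=
  g.vertex '' B ∪ ⋃ e ∈ (tangencyGraph B).edgeSet, g.edgeArc e

/-- The faces of the embedded graph `G_B`: the connected components of the complement of its
closure. (For finite `B` the embedded graph is closed. For infinite `B` the closure adds the
accumulation point and, in the circles through it, the limits of the edges.) -/
def faces (B : Set OrientedCircle) : Set (Set RiemannSphere) :=
  {Φ | ∃ z ∈ (closure (g.realization B))ᶜ,
    Φ = connectedComponentIn (closure (g.realization B))ᶜ z}

end DiscParametrization

/-- The embedded tangency graphs of `B` and `B'` are duals of each other: the vertices of each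
graph correspond to the faces of the other one, and the edges of the two graphs correspond to each
other in such a way that an edge of one graph borders exactly the two faces which are the ends of
the corresponding edge of the other. As the graphs are drawn in the sphere without the accumulation
point, an edge through that point takes no part in the duality. -/
structure PlanarDuality (B B' : Set OrientedCircle) where
  param : DiscParametrization
  face : B' ≃ param.faces B
  face' : B ≃ param.faces B'
  edge : regularEdges B (B ∪ B') ≃ regularEdges B' (B ∪ B')
  borders_iff : ∀ (e : regularEdges B (B ∪ B')) (d : B'),
    param.edgeArc e.1 ⊆ frontier (face d : Set RiemannSphere) ↔ d ∈ (edge e).1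
  borders_iff' : ∀ (e : regularEdges B (B ∪ B')) (c : B),
    param.edgeArc (edge e).1 ⊆ frontier (face' c : Set RiemannSphere) ↔ c ∈ e.1

/-- `c` and `d` form a face-vertex pair: the vertex `c` lies on the boundary of the face `d` of
`G_B`, and the vertex `d` lies on the boundary of the face `c` of `G_B'`. -/
def PlanarDuality.IsFaceVertexPair {B B' : Set OrientedCircle} (D : PlanarDuality B B')
    (c : B) (d : B') : Prop :=
  D.param.vertex c.1 ∈ frontier (D.face d : Set RiemannSphere) ∧
    D.param.vertex d.1 ∈ frontier (D.face' c : Set RiemannSphere)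

/-- The circles in `B` are pairwise disjoint or tangent, with disjoint interiors. -/
def HasDisjointInteriors (B : Set OrientedCircle) : Prop :=
  B.Pairwise fun c c' =>
    (c.IsDisjointFrom c' ∨ c.IsTangentTo c') ∧ Disjoint c.interior c'.interior

/-- `B` is a base configuration and `B'` is a dual configuration. -/
structure IsBaseDualPair (B B' : Set OrientedCircle) : Prop where
  disjointInteriors : HasDisjointInteriors B
  disjointInteriors' : HasDisjointInteriors B'
  nontrivial : B.Nontrivial
  nontrivial' : B'.Nontrivial
  connected : (tangencyGraph B).Connected
  connected' : (tangencyGraph B').Connected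
  dual : ∃ D : PlanarDuality B B', ∀ (c : B) (d : B'),
    (c.1.curve ∩ d.1.curve).Nonempty → c.1.IsOrthogonalTo d.1 ∧ D.IsFaceVertexPair c d
  disjoint_of_not_meet : ∀ c ∈ B, ∀ d ∈ B',
    c.IsDisjointFrom d → Disjoint c.interior d.interior
  accumulation : {x | AccumulatesAt (B ∪ B') x}.Subsingleton

/-! ### Superpackings and symmetry groups -/

/-- The group generated by the reflections across the circles in `F`. -/
def reflectionGroup (F : Set OrientedCircle) : Subgroup Moebius :=
  Subgroup.closure (reflection '' F)

/-- The group generated by the reflections across the circles in `B` and across those in `B'`. -/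
def supergroup (B B' : Set OrientedCircle) : Subgroup Moebius :=
  reflectionGroup B' ⊔ reflectionGroup B

/-- The orbit of a collection of circles under a group of Möbius transformations. -/
def orbitOf (W : Subgroup Moebius) (F : Set OrientedCircle) : Set OrientedCircle :=
  {c | ∃ w ∈ W, ∃ c₀ ∈ F, c = w • c₀}

/-- The superpacking: the orbit of `B` under the supergroup. -/
def superpacking (B B' : Set OrientedCircle) : Set OrientedCircle :=
  orbitOf (supergroup B B') B

/-- The dual superpacking: the orbit of the dual configuration under the supergroup. -/
def dualSuperpacking (B B' : Set OrientedCircle) : Set OrientedCircle :=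
  orbitOf (supergroup B B') B'

/-- The group of Möbius transformations that preserve both `F` and `F'`. -/
def symmetryGroup (F F' : Set OrientedCircle) : Subgroup Moebius :=
  MulAction.stabilizer Moebius F ⊓ MulAction.stabilizer Moebius F'

end CirclePacking

end

noncomputable section

namespace CirclePacking

/-! An oriented circle has a unit spacelike normal in Minkowski space of dimension 3 + 1, and future
timelike vectors represent points of hyperbolic 3-space. Möbius transformations act by Lorentz
transformations, and the reflection across a circle acts as the linear reflection in its normal
(`normal_reflection_smul`). The half-space over the interior of `c` is where `lor x (normal c)` is
positive.

Put `E = B ∪ B'`. Two distinct circles of `E` are either orthogonal, so that their normals have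
product zero, or separated: the sum of their normals is a nonzero causal vector, so that no point
lies in both closed half-spaces (`isCausal_add_of_disjoint_caps`, `areSeparated_of_disjoint`). Hence
the reflections across `E` generate a right-angled reflection group `W`, which is `supergroup B B'`.
Its chamber is the region outside all the half-spaces; it is nonempty
(`IsSeparatedPair.chamber_nonempty`) and its walls are locally finite (`finite_setOf_snd_le`).

The usual facts about reflection groups are proved here geometrically. No wall of the tessellation
cuts the chamber, and the side on which it lies is governed by word length (`lor_neg_or_lor_pos`).
It follows that `W` acts freely on chambers (`eq_one_of_forall_inv_smul_mem`) and that distinct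
circles of `E` lie in different `W`-orbits (`eq_of_smul_eq`). By local finiteness the translates of
the closed chamber cover hyperbolic space (`exists_mem_closedChamber`).

A symmetry of both superpackings permutes all walls. Composed with a suitable element of `W` it
preserves the chamber, hence permutes `E` (`smul_mem_of_lor_eq`). Since it preserves the `W`-orbits
of `B` and of `B'`, and these meet `E` exactly in `B` and in `B'`, it lies in `Γ₂`. So `W` and `Γ₂`
generate the symmetry group. They meet trivially because `W` acts freely, and `Γ₂` normalizes `W`
because it permutes the generators. -/

/-! ### Minkowski space -/

/-- Minkowski space of dimension `3 + 1`. -/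
abbrev Minkowski : Type := EuclideanSpace ℝ (Fin 3) × ℝ

/-- The Lorentz form. -/
def lor (x y : Minkowski) : ℝ := inner ℝ x.1 y.1 - x.2 * y.2

lemma lor_comm (x y : Minkowski) : lor x y = lor y x := by
  simp only [lor, real_inner_comm]; ring

lemma lor_add_left (x y z : Minkowski) : lor (x + y) z = lor x z + lor y z := by
  simp only [lor, Prod.fst_add, Prod.snd_add, inner_add_left]; ring

lemma lor_sub_left (x y z : Minkowski) : lor (x - y) z = lor x z - lor y z := by
  simp only [lor, Prod.fst_sub, Prod.snd_sub, inner_sub_left]; ring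

lemma lor_smul_left (k : ℝ) (x z : Minkowski) : lor (k • x) z = k * lor x z := by
  simp only [lor, Prod.smul_fst, Prod.smul_snd, real_inner_smul_left, smul_eq_mul]; ring

lemma lor_neg_left (x z : Minkowski) : lor (-x) z = -lor x z := by
  simp only [lor, Prod.fst_neg, Prod.snd_neg, inner_neg_left]; ring

lemma lor_zero_left (z : Minkowski) : lor 0 z = 0 := by simp [lor]

lemma lor_add_right (x y z : Minkowski) : lor z (x + y) = lor z x + lor z y := by
  simp only [lor_comm z, lor_add_left]

lemma lor_sub_right (x y z : Minkowski) : lor z (x - y) = lor z x - lor z y := by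
  simp only [lor_comm z, lor_sub_left]

lemma lor_smul_right (k : ℝ) (x z : Minkowski) : lor z (k • x) = k * lor z x := by
  simp only [lor_comm z, lor_smul_left]

lemma lor_neg_right (x z : Minkowski) : lor z (-x) = -lor z x := by
  simp only [lor_comm z, lor_neg_left]

lemma lor_self (x : Minkowski) : lor x x = ‖x.1‖ ^ 2 - x.2 ^ 2 := by
  simp only [lor, real_inner_self_eq_norm_sq]; ring

@[fun_prop]
lemma continuous_lor {X : Type*} [TopologicalSpace X] {f g : X → Minkowski} (hf : Continuous f)
    (hg : Continuous g) : Continuous fun x => lor (f x) (g x) := by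
  unfold lor; fun_prop

lemma lor_sum_left {ι : Type*} (s : Finset ι) (f : ι → Minkowski) (z : Minkowski) :
    lor (∑ i ∈ s, f i) z = ∑ i ∈ s, lor (f i) z := by
  induction s using Finset.cons_induction with
  | empty => simp [lor_zero_left]
  | cons a s ha ih => simp [lor_add_left, ih]

/-- Future-directed timelike vectors: representatives of the points of hyperbolic space. -/
def IsTimelike (x : Minkowski) : Prop := ‖x.1‖ < x.2

/-- The closed future cone. -/
def IsCausal (x : Minkowski) : Prop := ‖x.1‖ ≤ x.2

lemma IsTimelike.isCausal {x : Minkowski} (h : IsTimelike x) : IsCausal x := le_of_lt h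

lemma isTimelike_iff {x : Minkowski} : IsTimelike x ↔ lor x x < 0 ∧ 0 < x.2 := by
  rw [lor_self, IsTimelike]
  constructor
  · intro h
    have := norm_nonneg x.1
    exact ⟨by nlinarith, by linarith⟩
  · rintro ⟨h, h0⟩
    exact lt_of_pow_lt_pow_left₀ 2 h0.le (by linarith)

lemma isTimelike_zero_one : IsTimelike (0, 1) := by simp [IsTimelike]

lemma IsCausal.smul {x : Minkowski} (hx : IsCausal x) {k : ℝ} (hk : 0 ≤ k) : IsCausal (k • x) := by
  simp only [IsCausal, Prod.smul_fst, Prod.smul_snd, norm_smul, Real.norm_of_nonneg hk,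
    smul_eq_mul]
  exact mul_le_mul_of_nonneg_left hx hk

lemma IsTimelike.add_isCausal {x y : Minkowski} (hx : IsTimelike x) (hy : IsCausal y) :
    IsTimelike (x + y) :=
  (norm_add_le _ _).trans_lt (add_lt_add_of_lt_of_le hx hy)

lemma IsTimelike.smul {x : Minkowski} (hx : IsTimelike x) {k : ℝ} (hk : 0 < k) :
    IsTimelike (k • x) := by
  simp only [IsTimelike, Prod.smul_fst, Prod.smul_snd, norm_smul, Real.norm_of_nonneg hk.le,
    smul_eq_mul]
  exact mul_lt_mul_of_pos_left hx hk

lemma isOpen_isTimelike : IsOpen {x | IsTimelike x} :=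
  isOpen_lt (by fun_prop) (by fun_prop)

lemma IsCausal.lor_self_nonpos {x : Minkowski} (hx : IsCausal x) : lor x x ≤ 0 := by
  rw [lor_self]
  have := norm_nonneg x.1
  have : ‖x.1‖ ≤ x.2 := hx
  nlinarith

lemma IsCausal.snd_pos {x : Minkowski} (hx : IsCausal x) (h0 : x ≠ 0) : 0 < x.2 := by
  have h1 : ‖x.1‖ ≤ x.2 := hx
  rcases ((norm_nonneg x.1).trans h1).lt_or_eq with h | h
  · exact h
  · refine absurd (Prod.ext ?_ h.symm) h0
    rw [← h] at h1
    exact norm_le_zero_iff.1 h1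

lemma IsCausal.lor_neg {x y : Minkowski} (hx : IsCausal x) (h0 : x ≠ 0) (hy : IsTimelike y) :
    lor x y < 0 := by
  have h1 := hx.snd_pos h0
  have h2 := real_inner_le_norm x.1 y.1
  have hx' : ‖x.1‖ ≤ x.2 := hx
  have hy' : ‖y.1‖ < y.2 := hy
  have := norm_nonneg y.1
  unfold lor
  nlinarith [norm_nonneg x.1]

/-- Two nonzero causal vectors whose sum is not timelike are null and positively proportional. -/
lemma IsCausal.exists_eq_smul {x y : Minkowski} (hx : IsCausal x) (hy : IsCausal y) (hx0 : x ≠ 0)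
    (hy0 : y ≠ 0) (h : ¬ IsTimelike (x + y)) : ∃ k : ℝ, 0 < k ∧ y = k • x := by
  have h1 := hx.snd_pos hx0
  have h2 := hy.snd_pos hy0
  have hx' : ‖x.1‖ ≤ x.2 := hx
  have hy' : ‖y.1‖ ≤ y.2 := hy
  have h3 : x.2 + y.2 ≤ ‖x.1 + y.1‖ := not_lt.1 h
  have h4 := norm_add_le x.1 y.1
  have ex : ‖x.1‖ = x.2 := by linarith
  have ey : ‖y.1‖ = y.2 := by linarith
  -- Equality holds in the triangle inequality for the spatial parts.
  have hr : SameRay ℝ x.1 y.1 := sameRay_iff_norm_add.2 (by linarith)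
  have hn := hr.norm_smul_eq
  refine ⟨y.2 / x.2, div_pos h2 h1, Prod.ext ?_ ?_⟩
  · rw [ex, ey] at hn
    rw [Prod.smul_fst, div_eq_inv_mul, mul_smul, ← hn, inv_smul_smul₀ h1.ne']
  · simp [div_mul_cancel₀ _ h1.ne']

/-- The reflection of Minkowski space in the hyperplane orthogonal to the unit vector `e`. -/
def lorReflect (e x : Minkowski) : Minkowski := x - (2 * lor x e) • e

lemma lor_lorReflect_left (e x y : Minkowski) :
    lor (lorReflect e x) y = lor x y - 2 * lor x e * lor e y := by
  rw [lorReflect, lor_sub_left, lor_smul_left]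

lemma lor_lorReflect_lorReflect {e : Minkowski} (he : lor e e = 1) (x y : Minkowski) :
    lor (lorReflect e x) (lorReflect e y) = lor x y := by
  simp only [lorReflect, lor_sub_left, lor_smul_left, lor_sub_right, lor_smul_right, he,
    lor_comm e]
  ring

lemma lorReflect_lorReflect {e : Minkowski} (he : lor e e = 1) (x : Minkowski) :
    lorReflect e (lorReflect e x) = x := by
  rw [lorReflect, lor_lorReflect_left, he, lorReflect, sub_sub, ← add_smul]
  have : 2 * lor x e + 2 * (lor x e - 2 * lor x e * 1) = 0 := by ring
  rw [this, zero_smul, sub_zero]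

/-- A timelike vector which is negative on some causal vector is future-directed. -/
lemma isTimelike_of_lor_neg {x y : Minkowski} (hx : lor x x < 0) (hy : IsCausal y)
    (h : lor x y < 0) : IsTimelike x := by
  by_contra hn
  have h1 : ‖x.1‖ < ‖x.2‖ := by
    rw [lor_self] at hx
    rw [Real.norm_eq_abs]
    exact abs_norm x.1 ▸ sq_lt_sq.1 (by linarith)
  have h2 : x.2 ≤ 0 := by
    by_contra h3
    rw [Real.norm_of_nonneg (not_le.1 h3).le] at h1
    exact hn h1
  have h3 : IsTimelike (-x) := by
    rw [Real.norm_of_nonpos h2] at h1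
    simpa [IsTimelike] using h1
  have h0 : y ≠ 0 := by
    rintro rfl
    rw [lor_comm, lor_zero_left] at h
    exact h.false
  have := hy.lor_neg h0 h3
  rw [lor_neg_right, lor_comm] at this
  linarith

/-- The reflected vector `x'` satisfies `lor x' x = lor x x - 2 * lor x e ^ 2 < 0`, so it stays in
the same half of the cone as `x`. -/
lemma lorReflect_isTimelike {e x : Minkowski} (he : lor e e = 1) (hx : IsTimelike x) :
    IsTimelike (lorReflect e x) := by
  have hQ := (isTimelike_iff.1 hx).1
  refine isTimelike_of_lor_neg (y := x) (by rwa [lor_lorReflect_lorReflect he]) hx.isCausal ?_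
  rw [lor_lorReflect_left, lor_comm e x]
  nlinarith [sq_nonneg (lor x e)]

@[fun_prop]
lemma continuous_lorReflect (e : Minkowski) : Continuous (lorReflect e) := by
  unfold lorReflect; fun_prop

lemma eq_of_forall_lor_eq {x y : Minkowski} (h : ∀ z, lor x z = lor y z) : x = y := by
  have h1 : x.1 = y.1 := by
    refine ext_inner_right ℝ fun v => ?_
    simpa [lor] using h (v, 0)
  exact Prod.ext h1 (by simpa [lor] using h (0, 1))

/-! ### Spherical caps -/

lemma exists_norm_sq_eq_inner_eq_zero (v : EuclideanSpace ℝ (Fin 3)) {r : ℝ} (hr : 0 ≤ r) :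
    ∃ w : EuclideanSpace ℝ (Fin 3), ‖w‖ ^ 2 = r ∧ inner ℝ w v = 0 := by
  have h : ∃ w : EuclideanSpace ℝ (Fin 3), w ≠ 0 ∧ inner ℝ w v = 0 := by
    by_cases hv : v = 0
    · exact ⟨!₂[1, 0, 0], fun h => by simpa using congrArg (· 0) h, by simp [hv]⟩
    have h2 : 0 < Module.finrank ℝ (Submodule.span ℝ {v})ᗮ := by
      have : Fact (Module.finrank ℝ (EuclideanSpace ℝ (Fin 3)) = 2 + 1) := ⟨by simp⟩
      rw [Submodule.finrank_orthogonal_span_singleton (n := 2) hv]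
      norm_num
    have := Module.finrank_pos_iff.1 h2
    obtain ⟨w, hw⟩ := exists_ne (0 : (Submodule.span ℝ {v})ᗮ)
    exact ⟨w, by simpa using hw, Submodule.mem_orthogonal_singleton_iff_inner_left.1 w.2⟩
  obtain ⟨w, hw, hwv⟩ := h
  have hw' : ‖w‖ ≠ 0 := by simpa using hw
  refine ⟨(√r / ‖w‖) • w, ?_, by simp [real_inner_smul_left, hwv]⟩
  rw [norm_smul, mul_pow, Real.norm_eq_abs, sq_abs, div_pow, Real.sq_sqrt hr]
  field_simp

/-- A quarter turn of `v` towards `v'`: the part of `v'` orthogonal to `v`, rescaled to the length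
of `v`. The square of its product with `v'` is the Gram determinant of `v` and `v'`. If that
vanishes, any orthogonal vector of the right length will do. -/
lemma exists_orthogonal_norm_sq_inner {v v' : EuclideanSpace ℝ (Fin 3)} (hv : 0 < ‖v‖ ^ 2) :
    ∃ w : EuclideanSpace ℝ (Fin 3), ‖w‖ ^ 2 = ‖v‖ ^ 2 ∧ inner ℝ w v = 0 ∧
      0 ≤ inner ℝ w v' ∧ inner ℝ w v' ^ 2 = ‖v‖ ^ 2 * ‖v'‖ ^ 2 - inner ℝ v v' ^ 2 := by
  have hD : 0 ≤ ‖v‖ ^ 2 * ‖v'‖ ^ 2 - inner ℝ v v' ^ 2 := by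
    have := real_inner_mul_inner_self_le v v'
    simp only [real_inner_self_eq_norm_sq] at this
    nlinarith
  set D := ‖v‖ ^ 2 * ‖v'‖ ^ 2 - inner ℝ v v' ^ 2 with hDdef
  set y := (‖v‖ ^ 2) • v' - (inner ℝ v v') • v with hy
  have y1 : inner ℝ y v = 0 := by
    simp only [hy, inner_sub_left, real_inner_smul_left, real_inner_self_eq_norm_sq,
      real_inner_comm v' v]
    rw [real_inner_comm v v']; ring
  have y2 : inner ℝ y v' = D := by
    simp only [hy, inner_sub_left, real_inner_smul_left, real_inner_self_eq_norm_sq, hDdef]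
    ring
  have y3 : ‖y‖ ^ 2 = ‖v‖ ^ 2 * D := by
    rw [← real_inner_self_eq_norm_sq, hy, inner_sub_right, ← hy, real_inner_smul_right,
      real_inner_smul_right, y1, y2]
    ring
  rcases hD.lt_or_eq with h | h
  · have hs : √D ≠ 0 := (Real.sqrt_pos.2 h).ne'
    refine ⟨(√D)⁻¹ • y, ?_, by simp [real_inner_smul_left, y1], ?_, ?_⟩
    · rw [norm_smul, mul_pow, y3, Real.norm_eq_abs, sq_abs, inv_pow, Real.sq_sqrt hD]
      field_simp
    · rw [real_inner_smul_left, y2]; positivity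
    · rw [real_inner_smul_left, y2, mul_pow, inv_pow, Real.sq_sqrt hD]
      field_simp
  · obtain ⟨w, hw1, hw2⟩ := exists_norm_sq_eq_inner_eq_zero v hv.le
    have hy0 : y = 0 := by
      rw [← h, mul_zero] at y3
      simpa using y3
    have hw3 : inner ℝ w v' = 0 := by
      have := congrArg (inner ℝ w) hy0
      simp only [hy, inner_sub_right, real_inner_smul_right, hw2, inner_zero_right, mul_zero,
        sub_zero] at this
      exact (mul_eq_zero.1 this).resolve_left hv.ne'
    exact ⟨w, hw1, hw2, hw3.ge, by rw [hw3, ← h]; simp⟩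

/-- If the cap `e` of the unit sphere does not meet the cap `e'`, the parameters of the caps
satisfy the following inequalities. -/
lemma lor_of_disjoint_caps {e e' : Minkowski} (he : lor e e = 1) (he' : lor e' e' = 1)
    (H : ∀ u : EuclideanSpace ℝ (Fin 3), ‖u‖ = 1 → e.2 < inner ℝ u e.1 → inner ℝ u e'.1 ≤ e'.2) :
    1 ≤ lor e e' ^ 2 ∧ e.2 * lor e e' ≤ e'.2 ∧ inner ℝ e.1 e'.1 ≤ e'.2 * ‖e.1‖ := by
  obtain ⟨v, τ⟩ := e
  obtain ⟨v', τ'⟩ := e'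
  rw [lor_self] at he he'
  dsimp only [lor] at he he' H ⊢
  have hA : 0 < ‖v‖ ^ 2 := by nlinarith [sq_nonneg τ]
  have hv : 0 < ‖v‖ := by
    rcases (norm_nonneg v).lt_or_eq with h | h
    · exact h
    · rw [← h] at hA; norm_num at hA
  have hτ : |τ| < ‖v‖ := by
    rw [← abs_norm v]; exact sq_lt_sq.1 (by linarith)
  -- a scaled form of the hypothesis
  have H1 : ∀ x : EuclideanSpace ℝ (Fin 3), x ≠ 0 → τ * ‖x‖ < inner ℝ x v →
      inner ℝ x v' ≤ τ' * ‖x‖ := by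
    intro x hx h
    have hx' : 0 < ‖x‖ := norm_pos_iff.2 hx
    have := H (‖x‖⁻¹ • x) (by simp [norm_smul, hx'.ne'])
    rw [real_inner_smul_left, real_inner_smul_left, ← div_eq_inv_mul, ← div_eq_inv_mul,
      lt_div_iff₀ hx', div_le_iff₀ hx'] at this
    exact this h
  -- the closed cap
  have H2 : ∀ u : EuclideanSpace ℝ (Fin 3), ‖u‖ = 1 → inner ℝ u v = τ → inner ℝ u v' ≤ τ' := by
    intro u hu huv
    -- Moving `u` by `s` towards the pole of the cap puts it into the open cap, at a cost linear in
    -- `s`; then `s` tends to `0`.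
    have key : ∀ s : ℝ, 0 < s → s < 1 →
        inner ℝ u v' - τ' ≤ s * (|τ'| + |inner ℝ (‖v‖⁻¹ • v) v'|) := by
      intro s hs hs1
      have hc : ‖s • ‖v‖⁻¹ • v‖ = s := by
        rw [norm_smul, norm_smul, norm_inv, norm_norm, inv_mul_cancel₀ hv.ne', mul_one,
          Real.norm_of_nonneg hs.le]
      have n1 : ‖u + s • ‖v‖⁻¹ • v‖ ≤ 1 + s := by
        have := norm_add_le u (s • ‖v‖⁻¹ • v); linarith
      have n2 : 1 - s ≤ ‖u + s • ‖v‖⁻¹ • v‖ := by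
        have := norm_sub_le (u + s • ‖v‖⁻¹ • v) (s • ‖v‖⁻¹ • v)
        rw [add_sub_cancel_right] at this; linarith
      have bound : ∀ t : ℝ, |t * ‖u + s • ‖v‖⁻¹ • v‖ - t| ≤ s * |t| := by
        intro t
        rw [← mul_sub_one, abs_mul, mul_comm]
        exact mul_le_mul_of_nonneg_right (abs_le.2 ⟨by linarith, by linarith⟩) (abs_nonneg t)
      have := H1 (u + s • ‖v‖⁻¹ • v) (by
        intro h0; rw [h0, norm_zero] at n2; linarith) (by
        rw [inner_add_left, huv, real_inner_smul_left, real_inner_smul_left,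
          real_inner_self_eq_norm_sq]
        have e1 : ‖v‖⁻¹ * ‖v‖ ^ 2 = ‖v‖ := by field_simp
        rw [e1]
        have := (abs_le.1 (bound τ)).2
        nlinarith)
      rw [inner_add_left, real_inner_smul_left] at this
      have b2 := (abs_le.1 (bound τ')).2
      have b3 := neg_abs_le (inner ℝ (‖v‖⁻¹ • v) v')
      nlinarith
    by_contra hn
    have hpos : 0 < inner ℝ u v' - τ' := by linarith
    set K := |τ'| + |inner ℝ (‖v‖⁻¹ • v) v'| with hK
    have hK0 : 0 ≤ K := by positivity
    set δ := inner ℝ u v' - τ' with hδ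
    have hs : 0 < δ / (δ + K + 1) := by positivity
    have := key (δ / (δ + K + 1)) hs (by rw [div_lt_one (by positivity)]; linarith)
    rw [div_mul_eq_mul_div, le_div_iff₀ (by positivity)] at this
    nlinarith
  -- The point `(τ v + w) / ‖v‖²` of the boundary circle of the first cap is the one that reaches
  -- furthest into the second cap. It has norm `1` because `‖v‖² = 1 + τ²`.
  obtain ⟨w, w1, w2, w3, w4⟩ := exists_orthogonal_norm_sq_inner (v' := v') hA
  have hu := H2 ((‖v‖ ^ 2)⁻¹ • (τ • v + w)) (by
      have e1 : ‖τ • v + w‖ ^ 2 = (‖v‖ ^ 2) ^ 2 := by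
        rw [norm_add_sq_real, w1, real_inner_smul_left, real_inner_comm, w2, norm_smul, mul_pow,
          Real.norm_eq_abs, sq_abs]
        have : ‖v‖ ^ 2 = 1 + τ ^ 2 := by linarith
        rw [this]; ring
      have e2 : ‖τ • v + w‖ = ‖v‖ ^ 2 := by
        rwa [pow_left_inj₀ (norm_nonneg _) (by positivity) two_ne_zero] at e1
      rw [norm_smul, e2, norm_inv, norm_pow, norm_norm, inv_mul_cancel₀ hA.ne'])
    (by
      rw [real_inner_smul_left, inner_add_left, real_inner_smul_left, w2,
        real_inner_self_eq_norm_sq]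
      field_simp
      ring)
  rw [real_inner_smul_left, inner_add_left, real_inner_smul_left, ← div_eq_inv_mul,
    div_le_iff₀ hA] at hu
  have hA1 : ‖v‖ ^ 2 = 1 + τ ^ 2 := by linarith
  have hA2 : ‖v'‖ ^ 2 = 1 + τ' ^ 2 := by linarith
  rw [hA1, hA2] at w4
  rw [hA1] at hu
  set g := inner ℝ v v' with hg
  set ω := inner ℝ w v' with hω
  have h1 : ω ≤ τ' - τ * (g - τ * τ') := by nlinarith
  refine ⟨?_, by linarith, ?_⟩
  · have h2 : ω ^ 2 ≤ (τ' - τ * (g - τ * τ')) ^ 2 := pow_le_pow_left₀ w3 h1 2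
    rw [w4] at h2
    have h3 : (1 + τ ^ 2) * 1 ≤ (1 + τ ^ 2) * (g - τ * τ') ^ 2 := by nlinarith
    exact le_of_mul_le_mul_left h3 (by positivity)
  -- The pole of the first cap lies outside the second one.
  · exact H1 v (norm_pos_iff.1 hv) (by
      rw [real_inner_self_eq_norm_sq, sq]
      exact mul_lt_mul_of_pos_right ((le_abs_self τ).trans_lt hτ) hv)

/-- Disjoint caps of the unit sphere have causal sum. -/
theorem isCausal_add_of_disjoint_caps {e e' : Minkowski} (he : lor e e = 1) (he' : lor e' e' = 1)
    (H : ∀ u : EuclideanSpace ℝ (Fin 3), ‖u‖ = 1 → e.2 < inner ℝ u e.1 → inner ℝ u e'.1 ≤ e'.2) :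
    IsCausal (e + e') := by
  obtain ⟨h1, h2, h3⟩ := lor_of_disjoint_caps he he' H
  obtain ⟨-, h5, h6⟩ := lor_of_disjoint_caps he' he fun u hu h => by
    by_contra hn
    exact absurd (H u hu (not_le.1 hn)) (not_le.2 h)
  rw [lor_comm] at h5
  rw [real_inner_comm] at h6
  have hQ : lor (e + e') (e + e') = 2 + 2 * lor e e' := by
    rw [lor_add_left, lor_add_right, lor_add_right, he, he', lor_comm e' e]; ring
  have hβ : inner ℝ e.1 e'.1 = lor e e' + e.2 * e'.2 := by unfold lor; ring
  rw [lor_self] at he he'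
  set β := lor e e'
  set τ := e.2
  set τ' := e'.2
  have a1 : |τ| < ‖e.1‖ := by
    rw [← abs_norm e.1]; exact sq_lt_sq.1 (by linarith)
  have a2 : |τ'| < ‖e'.1‖ := by
    rw [← abs_norm e'.1]; exact sq_lt_sq.1 (by linarith)
  -- The other possibility, `1 ≤ β`, corresponds to nested caps, and the conditions on the two poles
  -- exclude it: they bound `β * β` by a product of two factors less than `1`.
  have hβ1 : β ≤ -1 := by
    by_contra hn
    have hβ2 : 1 ≤ β := by nlinarith
    rw [hβ] at h3 h6
    have p1 : 0 < ‖e.1‖ - τ := by linarith [le_abs_self τ]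
    have p2 : 0 < ‖e'.1‖ - τ' := by linarith [le_abs_self τ']
    have q1 : β ≤ τ' * (‖e.1‖ - τ) := by linarith
    have q2 : β ≤ τ * (‖e'.1‖ - τ') := by linarith
    have t1 : 0 < τ' := by
      by_contra h; nlinarith
    have t2 : 0 < τ := by
      by_contra h; nlinarith
    have r1 : τ * (‖e.1‖ - τ) < 1 := by
      have : (‖e.1‖ - τ) * (‖e.1‖ + τ) = 1 := by linarith
      nlinarith
    have r2 : τ' * (‖e'.1‖ - τ') < 1 := by
      have : (‖e'.1‖ - τ') * (‖e'.1‖ + τ') = 1 := by linarith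
      nlinarith
    have s1 : β * β ≤ (τ' * (‖e.1‖ - τ)) * (τ * (‖e'.1‖ - τ')) :=
      mul_le_mul q1 q2 (by linarith) (by positivity)
    have s2 : (τ * (‖e.1‖ - τ)) * (τ' * (‖e'.1‖ - τ')) < 1 * 1 :=
      mul_lt_mul'' r1 r2 (by positivity) (by positivity)
    nlinarith
  have hτ : 0 ≤ τ + τ' := by
    by_contra hn
    rcases le_total τ τ' with h | h <;> nlinarith
  rw [lor_self] at hQ
  exact le_of_pow_le_pow_left₀ two_ne_zero hτ (by linarith)

/-- A set of unit vectors with pairwise causal sums is locally finite. -/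
theorem finite_setOf_snd_le {S : Set Minkowski} (h1 : ∀ e ∈ S, lor e e = 1)
    (h2 : S.Pairwise fun e e' => IsCausal (e + e')) (R : ℝ) : {e ∈ S | e.2 ≤ R}.Finite := by
  rcases S.eq_empty_or_nonempty with rfl | ⟨e₁, he₁⟩
  · simp
  -- The causal sum with one fixed `e₁` bounds the time coordinates from below.
  obtain ⟨C, hC⟩ : ∃ C, ∀ e ∈ S, e.2 ≤ R → |e.2| ≤ C := by
    refine ⟨|R| + |e₁.2|, fun e he hR => abs_le.2 ⟨?_, ?_⟩⟩
    · by_cases h : e = e₁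
      · rw [h]; linarith [neg_abs_le e₁.2, abs_nonneg R]
      · have h3 : ‖(e + e₁).1‖ ≤ e.2 + e₁.2 := h2 he he₁ h
        linarith [norm_nonneg (e + e₁).1, le_abs_self e₁.2, abs_nonneg R]
    · linarith [le_abs_self R, abs_nonneg e₁.2]
  have hsub : {e ∈ S | e.2 ≤ R} ⊆ Metric.closedBall 0 (1 + C) := by
    rintro e ⟨he, hR⟩
    have h3 := h1 e he
    rw [lor_self] at h3
    have h4 := hC e he hR
    have h5 := abs_nonneg e.2
    rw [mem_closedBall_zero_iff, Prod.norm_def, Real.norm_eq_abs]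
    refine max_le (le_of_pow_le_pow_left₀ two_ne_zero (by linarith) ?_) (by linarith)
    nlinarith [sq_abs e.2]
  have htb : TotallyBounded {e ∈ S | e.2 ≤ R} :=
    (isCompact_closedBall _ _).totallyBounded.subset hsub
  obtain ⟨t, ht, hcov⟩ := Metric.totallyBounded_iff.1 htb 1 one_pos
  refine (ht.biUnion (t := fun y => {e ∈ S | e.2 ≤ R} ∩ Metric.ball y 1) fun y _ => ?_).subset
    fun e he => by
      obtain ⟨y, hy, hb⟩ := mem_iUnion₂.1 (hcov he)
      exact mem_iUnion₂.2 ⟨y, hy, he, hb⟩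
  refine Set.Subsingleton.finite ?_
  rintro e ⟨⟨he, -⟩, hb⟩ e' ⟨⟨he', -⟩, hb'⟩
  by_contra hne
  have hd : dist e e' < 2 := by
    have := dist_triangle_right e e' y
    rw [Metric.mem_ball] at hb hb'
    linarith
  have hd1 : ‖(e - e').1‖ < 2 := by
    rw [dist_eq_norm] at hd
    exact (norm_fst_le _).trans_lt hd
  have h3 := (h2 he he' hne).lor_self_nonpos
  -- A causal sum means `lor e e' ≤ -1`, so distinct elements of `S` have spatial distance at least
  -- `2`. A bounded set with this property is finite.
  have h4 : 4 ≤ lor (e - e') (e - e') := by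
    simp only [lor_add_left, lor_add_right, lor_sub_left, lor_sub_right, h1 e he, h1 e' he'] at h3 ⊢
    linarith
  rw [lor_self] at h4
  nlinarith [norm_nonneg (e - e').1, sq_nonneg (e - e').2]

/-- A unit vector whose time coordinate is large is far from a given timelike vector. -/
lemma lor_neg_of_lt_snd {x e : Minkowski} (he : lor e e = 1) {r δ : ℝ} (hδ : 0 < δ)
    (hr : ‖x.1‖ ≤ r) (hx : ‖x.1‖ + δ ≤ x.2) (h : r / δ < e.2) : lor x e < 0 := by
  have h0 := norm_nonneg x.1
  have hτ : 0 < e.2 := lt_of_le_of_lt (div_nonneg (h0.trans hr) hδ.le) h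
  rw [div_lt_iff₀ hδ] at h
  have h1 : ‖e.1‖ ≤ 1 + e.2 := by
    rw [lor_self] at he
    exact le_of_pow_le_pow_left₀ two_ne_zero (by linarith) (by nlinarith)
  have h2 := real_inner_le_norm x.1 e.1
  unfold lor
  nlinarith

/-! ### Unit normals of oriented circles -/

/-- The vector of Minkowski space with the coefficients `a`, `b`, `d`. -/
def vec (a : ℝ) (b : ℂ) (d : ℝ) : Minkowski := (!₂[b.re, b.im, (a - d) / 2], (a + d) / 2)

/-- The leading coefficient of the equation given by a vector of Minkowski space. -/
def coeffA (x : Minkowski) : ℝ := x.2 + x.1 2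

/-- The linear coefficient of the equation given by a vector of Minkowski space. -/
def coeffB (x : Minkowski) : ℂ := ⟨x.1 0, x.1 1⟩

/-- The constant coefficient of the equation given by a vector of Minkowski space. -/
def coeffD (x : Minkowski) : ℝ := x.2 - x.1 2

@[simp] lemma coeffA_vec (a : ℝ) (b : ℂ) (d : ℝ) : coeffA (vec a b d) = a := by
  simp [coeffA, vec]; ring

@[simp] lemma coeffB_vec (a : ℝ) (b : ℂ) (d : ℝ) : coeffB (vec a b d) = b := by
  simp [coeffB, vec]

@[simp] lemma coeffD_vec (a : ℝ) (b : ℂ) (d : ℝ) : coeffD (vec a b d) = d := by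
  simp [coeffD, vec]; ring

lemma vec_coeff (x : Minkowski) : vec (coeffA x) (coeffB x) (coeffD x) = x := by
  refine Prod.ext ?_ ?_
  · ext i
    fin_cases i <;> simp [vec, coeffA, coeffB, coeffD]
  · simp [vec, coeffA, coeffD]

lemma exists_eq_vec (x : Minkowski) : ∃ a b d, x = vec a b d := ⟨_, _, _, (vec_coeff x).symm⟩

lemma lor_vec (a : ℝ) (b : ℂ) (d a' : ℝ) (b' : ℂ) (d' : ℝ) :
    lor (vec a b d) (vec a' b' d') = (b * conj b').re - (a * d' + a' * d) / 2 := by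
  simp [lor, vec, PiLp.inner_apply, Fin.sum_univ_three]
  ring

lemma lor_vec_self (a : ℝ) (b : ℂ) (d : ℝ) :
    lor (vec a b d) (vec a b d) = Complex.normSq b - a * d := by
  rw [lor_vec, Complex.mul_conj, Complex.ofReal_re]; ring

lemma smul_vec (k a : ℝ) (b : ℂ) (d : ℝ) : k • vec a b d = vec (k * a) (k * b) (k * d) := by
  refine Prod.ext ?_ ?_
  · ext i
    fin_cases i <;> simp [vec]
    ring
  · simp [vec]; ring

lemma vec_sub_vec (a : ℝ) (b : ℂ) (d a' : ℝ) (b' : ℂ) (d' : ℝ) :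
    vec a b d - vec a' b' d' = vec (a - a') (b - b') (d - d') := by
  refine Prod.ext ?_ ?_
  · ext i
    fin_cases i <;> simp [vec]
    ring
  · simp [vec]; ring

/-- The left-hand side of the equation given by a vector of Minkowski space. -/
def form (e : Minkowski) (z : RiemannSphere) : ℝ := circleForm (coeffA e) (coeffB e) (coeffD e) z

lemma form_infty (e : Minkowski) : form e ∞ = coeffA e := by
  change hermForm _ _ _ 1 0 = _
  simp [hermForm]

lemma form_coe (e : Minkowski) (z : ℂ) :
    form e z = coeffA e * Complex.normSq z - 2 * (conj (coeffB e) * z).re + coeffD e := by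
  change hermForm _ _ _ z 1 = _
  simp [hermForm]

lemma form_vec (a : ℝ) (b : ℂ) (d : ℝ) (z : RiemannSphere) :
    form (vec a b d) z = circleForm a b d z := by
  simp [form]

lemma form_smul (k : ℝ) (e : Minkowski) (z : RiemannSphere) : form (k • e) z = k * form e z := by
  cases z using OnePoint.rec with
  | infty => simp [form_infty, coeffA]; ring
  | coe z => simp [form_coe, coeffA, coeffB, coeffD]; ring

lemma form_neg (e : Minkowski) (z : RiemannSphere) : form (-e) z = -form e z := by
  rw [← neg_one_smul ℝ, form_smul]; ring

/-- Stereographic projection: each point of the unit sphere is a point of the extended plane. -/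
lemma exists_form_eq {u : EuclideanSpace ℝ (Fin 3)} (hu : ‖u‖ = 1) :
    ∃ z, ∃ k : ℝ, 0 < k ∧ ∀ e, form e z = k * (e.2 - inner ℝ u e.1) := by
  have hu' : u 0 ^ 2 + u 1 ^ 2 + u 2 ^ 2 = 1 := by
    have := EuclideanSpace.norm_sq_eq u
    rw [hu, Fin.sum_univ_three] at this
    simpa using this.symm
  have hin : ∀ e : Minkowski, inner ℝ u e.1 = u 0 * e.1 0 + u 1 * e.1 1 + u 2 * e.1 2 := by
    intro e
    simp [PiLp.inner_apply, Fin.sum_univ_three]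
    ring
  by_cases h : u 2 = -1
  · have h0 : u 0 = 0 := by nlinarith [sq_nonneg (u 0), sq_nonneg (u 1)]
    have h1 : u 1 = 0 := by nlinarith [sq_nonneg (u 0), sq_nonneg (u 1)]
    refine ⟨∞, 1, one_pos, fun e => ?_⟩
    rw [form_infty, hin, h, h0, h1, coeffA]
    ring
  · have hpos : 0 < 1 + u 2 := by
      rcases lt_or_eq_of_le (show -1 ≤ u 2 by nlinarith [sq_nonneg (u 0), sq_nonneg (u 1)])
        with h' | h'
      · linarith
      · exact absurd h'.symm h
    refine ⟨((⟨u 0 / (1 + u 2), u 1 / (1 + u 2)⟩ : ℂ) : RiemannSphere), 2 / (1 + u 2),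
      by positivity, fun e => ?_⟩
    rw [form_coe, hin]
    simp only [coeffA, coeffB, coeffD, Complex.normSq_apply, Complex.mul_re, Complex.conj_re,
      Complex.conj_im]
    field_simp
    linear_combination (e.2 + e.1 2) * hu'

lemma isCausal_add_of_form {e e' : Minkowski} (he : lor e e = 1) (he' : lor e' e' = 1)
    (H : ∀ z, form e z < 0 → 0 ≤ form e' z) : IsCausal (e + e') := by
  refine isCausal_add_of_disjoint_caps he he' fun u hu h => ?_
  obtain ⟨z, k, hk, hz⟩ := exists_form_eq hu
  have := H z (by rw [hz]; exact mul_neg_of_pos_of_neg hk (by linarith))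
  rw [hz] at this
  linarith [nonneg_of_mul_nonneg_right this hk]

/-- The caps of `e` and `-e'` are disjoint, so `e - e'` is causal, and by symmetry so is `e' - e`.
Two opposite nonzero vectors cannot both be future-directed. -/
lemma eq_of_form_neg_iff {e e' : Minkowski} (he : lor e e = 1) (he' : lor e' e' = 1)
    (H : ∀ z, form e z < 0 ↔ form e' z < 0) : e = e' := by
  have key : ∀ {e e' : Minkowski}, lor e e = 1 → lor e' e' = 1 →
      (∀ z, form e z < 0 ↔ form e' z < 0) → IsCausal (e - e') := by
    intro e e' he he' H
    rw [sub_eq_add_neg]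
    refine isCausal_add_of_form he (by rw [lor_neg_left, lor_neg_right, neg_neg, he']) fun z hz => ?_
    rw [form_neg]
    linarith [(H z).1 hz]
  have h1 := key he he' H
  have h2 := key he' he fun z => (H z).symm
  by_contra hne
  have p1 := h1.snd_pos (sub_ne_zero.2 hne)
  have p2 := h2.snd_pos (sub_ne_zero.2 (Ne.symm hne))
  rw [Prod.snd_sub] at p1 p2
  linarith

/-- `e` is the unit normal of the hyperbolic plane over `c`, pointing to the side of the
interior. -/
structure IsNormalOf (e : Minkowski) (c : OrientedCircle) : Prop where
  lor_self : lor e e = 1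
  curve : c.curve = {z | form e z = 0}
  interior : c.interior = {z | form e z < 0}

lemma IsEquationOf.isNormalOf {a : ℝ} {b : ℂ} {d : ℝ} {c : OrientedCircle}
    (h : IsEquationOf a b d c.curve c.interior) :
    IsNormalOf ((√(Complex.normSq b - a * d))⁻¹ • vec a b d) c := by
  obtain ⟨h0, hC, hI⟩ := h
  have hs : 0 < (√(Complex.normSq b - a * d))⁻¹ := inv_pos.2 (Real.sqrt_pos.2 h0)
  refine ⟨?_, ?_, ?_⟩
  · rw [lor_smul_left, lor_smul_right, lor_vec_self, ← mul_assoc, ← mul_inv,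
      Real.mul_self_sqrt h0.le, inv_mul_cancel₀ h0.ne']
  · rw [hC]; ext z
    rw [mem_ofPred_eq, mem_ofPred_eq, form_smul, form_vec, mul_eq_zero, or_iff_right hs.ne']
  · rw [hI]; ext z
    simp only [mem_ofPred_eq, form_smul, form_vec, mul_neg_iff, hs, hs.le.not_gt]
    simp

lemma IsNormalOf.eq {e e' : Minkowski} {c : OrientedCircle} (h : IsNormalOf e c)
    (h' : IsNormalOf e' c) : e = e' :=
  eq_of_form_neg_iff h.lor_self h'.lor_self fun z => by
    have := h.interior.symm.trans h'.interior
    exact Set.ext_iff.1 this z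

lemma exists_isNormalOf (c : OrientedCircle) : ∃ e, IsNormalOf e c := by
  obtain ⟨a, b, d, h⟩ := c.exists_equation
  exact ⟨_, h.isNormalOf⟩

/-- The unit normal of an oriented circle. -/
def normal (c : OrientedCircle) : Minkowski := (exists_isNormalOf c).choose

lemma isNormalOf_normal (c : OrientedCircle) : IsNormalOf (normal c) c :=
  (exists_isNormalOf c).choose_spec

lemma lor_normal_self (c : OrientedCircle) : lor (normal c) (normal c) = 1 :=
  (isNormalOf_normal c).lor_self

lemma IsNormalOf.normal_eq {e : Minkowski} {c : OrientedCircle} (h : IsNormalOf e c) :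
    normal c = e :=
  (isNormalOf_normal c).eq h

lemma normal_injective : Function.Injective normal := fun c c' h => by
  have h1 := isNormalOf_normal c
  have h2 := isNormalOf_normal c'
  rw [h] at h1
  exact OrientedCircle.ext (h1.curve.trans h2.curve.symm) (h1.interior.trans h2.interior.symm)

lemma exists_normal_eq {e : Minkowski} (he : lor e e = 1) : ∃ c, normal c = e := by
  refine ⟨⟨{z | form e z = 0}, {z | form e z < 0}, coeffA e, coeffB e, coeffD e, ?_, rfl, rfl⟩, ?_⟩
  · rw [← lor_vec_self, vec_coeff, he]; exact one_pos
  · exact IsNormalOf.normal_eq ⟨he, rfl, rfl⟩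

lemma isCausal_normal_add {c c' : OrientedCircle} (h : Disjoint c.interior c'.interior) :
    IsCausal (normal c + normal c') := by
  refine isCausal_add_of_form (lor_normal_self c) (lor_normal_self c') fun z hz => ?_
  by_contra hn
  have h1 : z ∈ c.interior := by rw [(isNormalOf_normal c).interior]; exact hz
  have h2 : z ∈ c'.interior := by rw [(isNormalOf_normal c').interior]; exact not_le.1 hn
  exact Set.disjoint_left.1 h h1 h2

lemma OrientedCircle.IsOrthogonalTo.lor_eq_zero {c c' : OrientedCircle}
    (h : c.IsOrthogonalTo c') : lor (normal c) (normal c') = 0 := by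
  obtain ⟨a, b, d, a', b', d', h1, h2, h3⟩ := h
  rw [h1.isNormalOf.normal_eq, h2.isNormalOf.normal_eq, lor_smul_left, lor_smul_right, lor_vec]
  have : (b * conj b').re - (a * d' + a' * d) / 2 = 0 := by linarith
  rw [this, mul_zero, mul_zero]

/-- A circle has at least two points. -/
lemma OrientedCircle.nontrivial_curve (c : OrientedCircle) : c.curve.Nontrivial := by
  obtain ⟨a, b, d, h, hC, -⟩ := c.exists_equation
  rw [hC]
  by_cases ha : a = 0
  · subst ha
    have hb : 0 < Complex.normSq b := by simpa using h
    -- The second point is the point of the line nearest to the origin.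
    refine ⟨∞, ?_, ((d / (2 * Complex.normSq b) * b : ℂ) : RiemannSphere), ?_,
      OnePoint.infty_ne_coe _⟩
    · change hermForm _ _ _ _ _ = 0
      simp [hermForm]
    · change hermForm _ _ _ _ _ = 0
      have e : conj b * (d / (2 * Complex.normSq b) * b) * conj 1
          = ((d / 2 : ℝ) : ℂ) := by
        have hb' : (Complex.normSq b : ℂ) ≠ 0 := by exact_mod_cast hb.ne'
        have := Complex.mul_conj b
        rw [map_one]
        push_cast
        field_simp
        linear_combination (d : ℂ) * this
      rw [hermForm, e, Complex.ofReal_re]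
      simp
      ring
  -- For `ε = ±1` these are the ends of the diameter parallel to the real axis.
  · have key : ∀ ε : ℝ, ε ^ 2 = 1 →
        circleForm a b d ((((b + (ε * √(Complex.normSq b - a * d) : ℝ)) / a : ℂ)) : RiemannSphere)
          = 0 := by
      intro ε hε
      change hermForm _ _ _ _ _ = 0
      have hs := Real.sq_sqrt h.le
      set s := √(Complex.normSq b - a * d)
      have e1 : conj b * ((b + (ε * s : ℝ)) / a) * conj 1
          = ((Complex.normSq b / a : ℝ) : ℂ) + ((ε * s / a : ℝ) : ℂ) * conj b := by
        have hb := Complex.mul_conj b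
        have ha' : (a : ℂ) ≠ 0 := by exact_mod_cast ha
        rw [map_one]
        push_cast
        field_simp
        linear_combination hb
      have e2 : Complex.normSq (b + (ε * s : ℝ)) = Complex.normSq b + 2 * (ε * s) * b.re
          + (ε * s) ^ 2 := by
        simp only [Complex.normSq_apply, Complex.add_re, Complex.add_im, Complex.ofReal_re,
          Complex.ofReal_im]
        ring
      rw [hermForm, e1, Complex.normSq_div, e2, Complex.normSq_ofReal, Complex.add_re,
        Complex.re_ofReal_mul, Complex.ofReal_re, Complex.conj_re, Complex.normSq_one, mul_one,
        mul_pow, hε, hs]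
      field_simp
      ring
    refine ⟨_, key 1 (by norm_num), _, key (-1) (by norm_num), fun he => ?_⟩
    have ha' : (a : ℂ) ≠ 0 := by exact_mod_cast ha
    have he' := OnePoint.coe_injective he
    rw [div_left_inj' ha', add_right_inj, Complex.ofReal_inj] at he'
    have := Real.sqrt_pos.2 h
    linarith

/-- Circles which are disjoint or tangent and have disjoint interiors. -/
def AreSeparated (c c' : OrientedCircle) : Prop :=
  IsCausal (normal c + normal c') ∧ normal c + normal c' ≠ 0

lemma AreSeparated.symm {c c' : OrientedCircle} (h : AreSeparated c c') : AreSeparated c' c := by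
  unfold AreSeparated at *
  rwa [add_comm]

lemma AreSeparated.lor_le {c c' : OrientedCircle} (h : AreSeparated c c') :
    lor (normal c) (normal c') ≤ -1 := by
  have := h.1.lor_self_nonpos
  rw [lor_add_left, lor_add_right, lor_add_right, lor_normal_self, lor_normal_self,
    lor_comm (normal c')] at this
  linarith

/-- A nonzero causal vector has negative product with every timelike one, so no point of hyperbolic
space lies in both closed half-spaces. -/
lemma AreSeparated.lor_neg {c c' : OrientedCircle} (h : AreSeparated c c') {x : Minkowski}
    (hx : IsTimelike x) (hc : 0 ≤ lor x (normal c)) : lor x (normal c') < 0 := by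
  have := h.1.lor_neg h.2 hx
  rw [lor_comm, lor_add_right] at this
  linarith

lemma curve_eq_of_normal_add_eq_zero {c c' : OrientedCircle} (h : normal c + normal c' = 0) :
    c.curve = c'.curve := by
  rw [(isNormalOf_normal c).curve, (isNormalOf_normal c').curve, eq_neg_of_add_eq_zero_left h]
  simp [form_neg]

/-- Opposite normals would mean a common curve, which has at least two points, whereas disjoint or
tangent curves share at most one. -/
lemma areSeparated_of_disjoint {c c' : OrientedCircle} (h : Disjoint c.interior c'.interior)
    (h' : c.IsDisjointFrom c' ∨ c.IsTangentTo c') : AreSeparated c c' := by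
  refine ⟨isCausal_normal_add h, fun h0 => ?_⟩
  obtain ⟨x, hx, y, hy, hxy⟩ := c.nontrivial_curve
  rcases h' with h' | ⟨t, ht⟩
  · rw [OrientedCircle.IsDisjointFrom, ← curve_eq_of_normal_add_eq_zero h0, inter_self] at h'
    rw [h'] at hx
    exact hx
  · rw [← curve_eq_of_normal_add_eq_zero h0, inter_self] at ht
    rw [ht] at hx hy
    exact hxy (hx.trans hy.symm)

/-! ### Möbius transformations as Lorentz transformations -/

/-- `L` is the Lorentz transformation induced by the Möbius transformation `f`. -/
structure IsLift (f : Moebius) (L : Minkowski → Minkowski) : Prop where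
  lor : ∀ x y, lor (L x) (L y) = lor x y
  isTimelike : ∀ x, IsTimelike x → IsTimelike (L x)
  form : ∀ e z, ∃ k : ℝ, 0 < k ∧ form (L e) (f • z) = k * form e z

lemma IsLift.mul {f g : Moebius} {L K : Minkowski → Minkowski} (hf : IsLift f L)
    (hg : IsLift g K) : IsLift (f * g) (L ∘ K) where
  lor x y := (hf.lor _ _).trans (hg.lor _ _)
  isTimelike x hx := hf.isTimelike _ (hg.isTimelike _ hx)
  form e z := by
    obtain ⟨k, hk, h⟩ := hf.form (K e) (g • z)
    obtain ⟨l, hl, h'⟩ := hg.form e z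
    exact ⟨k * l, mul_pos hk hl, by rw [mul_smul, Function.comp_apply, h, h', mul_assoc]⟩

lemma IsLift.normal_smul {f : Moebius} {L : Minkowski → Minkowski} (h : IsLift f L)
    (c : OrientedCircle) : normal (f • c) = L (normal c) := by
  have hc := isNormalOf_normal c
  refine IsNormalOf.normal_eq ⟨(h.lor _ _).trans hc.lor_self, ?_, ?_⟩
  · change f • c.curve = _
    ext z
    obtain ⟨k, hk, e⟩ := h.form (normal c) (f⁻¹ • z)
    rw [smul_inv_smul] at e
    rw [Set.mem_smul_set_iff_inv_smul_mem, hc.curve, mem_ofPred_eq, mem_ofPred_eq, e]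
    simp [hk.ne']
  · change f • c.interior = _
    ext z
    obtain ⟨k, hk, e⟩ := h.form (normal c) (f⁻¹ • z)
    rw [smul_inv_smul] at e
    rw [Set.mem_smul_set_iff_inv_smul_mem, hc.interior, mem_ofPred_eq, mem_ofPred_eq, e]
    simp [mul_neg_iff, hk, hk.le, not_lt.2]

/-- Complex conjugation as an element of the Möbius group. -/
def conjMoebius : Moebius := ⟨conjPerm, 1, Or.inr (by simp)⟩

/-- The Lorentz transformation induced by complex conjugation. -/
def liftConj (x : Minkowski) : Minkowski := vec (coeffA x) (conj (coeffB x)) (coeffD x)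

lemma isLift_conjMoebius : IsLift conjMoebius liftConj := by
  have hl : ∀ x y, lor (liftConj x) (liftConj y) = lor x y := by
    intro x y
    rw [← vec_coeff x, ← vec_coeff y]
    simp [liftConj, lor_vec]
  refine ⟨hl, fun x hx => ?_, fun e z => ⟨1, one_pos, ?_⟩⟩
  · rw [isTimelike_iff] at hx ⊢
    refine ⟨by rw [hl]; exact hx.1, ?_⟩
    simpa [liftConj, vec, coeffA, coeffD] using hx.2
  · rw [one_mul, liftConj, form_vec]
    exact circleForm_conjPerm _ _ _ z

/-- A holomorphic Möbius transformation as an element of the Möbius group. -/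
def holMoebius (M : GL (Fin 2) ℂ) : Moebius := ⟨holPerm M, M, Or.inl rfl⟩

/-- The Lorentz transformation induced by `z ↦ (p z + q) / (r z + s)`, before scaling. -/
def preLift (p q r s : ℂ) (a : ℝ) (b : ℂ) (d : ℝ) : Minkowski :=
  vec (a * Complex.normSq s + 2 * (conj b * s * conj r).re + d * Complex.normSq r)
    (a * conj s * q + b * conj s * p + conj b * q * conj r + d * conj r * p)
    (a * Complex.normSq q + 2 * (conj b * q * conj p).re + d * Complex.normSq p)

/-- The factor is the squared modulus of the determinant; `liftHol` divides by the modulus to obtain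
a Lorentz transformation. -/
lemma lor_preLift (p q r s : ℂ) (a : ℝ) (b : ℂ) (d a' : ℝ) (b' : ℂ) (d' : ℝ) :
    lor (preLift p q r s a b d) (preLift p q r s a' b' d') =
      Complex.normSq (p * s - q * r) * lor (vec a b d) (vec a' b' d') := by
  simp only [preLift, lor_vec]
  simp only [Complex.normSq_apply, Complex.mul_re, Complex.mul_im, Complex.conj_re,
    Complex.conj_im, Complex.add_re, Complex.add_im, Complex.sub_re, Complex.sub_im,
    Complex.ofReal_re, Complex.ofReal_im]
  ring

lemma hermForm_preLift (p q r s : ℂ) (a : ℝ) (b : ℂ) (d : ℝ) (x y : ℂ) :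
    hermForm (coeffA (preLift p q r s a b d)) (coeffB (preLift p q r s a b d))
      (coeffD (preLift p q r s a b d)) (p * x + q * y) (r * x + s * y) =
      Complex.normSq (p * s - q * r) * hermForm a b d x y := by
  simp only [preLift, coeffA_vec, coeffB_vec, coeffD_vec]
  simp only [hermForm, Complex.normSq_apply, Complex.mul_re, Complex.mul_im, Complex.conj_re,
    Complex.conj_im, Complex.add_re, Complex.add_im, Complex.sub_re, Complex.sub_im,
    Complex.ofReal_re, Complex.ofReal_im]
  ring

lemma isTimelike_iff_coeff {x : Minkowski} :
    IsTimelike x ↔ Complex.normSq (coeffB x) < coeffA x * coeffD x ∧ 0 < coeffA x := by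
  have h1 : lor x x = Complex.normSq (coeffB x) - coeffA x * coeffD x := by
    rw [← lor_vec_self, vec_coeff]
  have h2 : 2 * x.2 = coeffA x + coeffD x := by simp [coeffA, coeffD]; ring
  have h3 := Complex.normSq_nonneg (coeffB x)
  rw [isTimelike_iff, h1, sub_neg]
  constructor
  · rintro ⟨h, h0⟩
    refine ⟨h, ?_⟩
    by_contra hn
    nlinarith
  · rintro ⟨h, h0⟩
    refine ⟨h, ?_⟩
    have : 0 < coeffD x := by
      by_contra hn; nlinarith
    linarith

/-- The sign of the quadratic form is preserved by `lor_preLift`. For the time direction, `a` times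
the new leading coefficient is `|a s + b r|² + (a d - |b|²) |r|²`, which is positive. -/
lemma isTimelike_preLift {p q r s : ℂ} (hdet : p * s - q * r ≠ 0) {a : ℝ} {b : ℂ} {d : ℝ}
    (h : IsTimelike (vec a b d)) : IsTimelike (preLift p q r s a b d) := by
  have h1 : Complex.normSq b < a * d ∧ 0 < a := by simpa using isTimelike_iff_coeff.1 h
  have hD := Complex.normSq_pos.2 hdet
  rw [isTimelike_iff_coeff]
  constructor
  · rw [← sub_neg, ← lor_vec_self, vec_coeff, lor_preLift, lor_vec_self]
    exact mul_neg_of_pos_of_neg hD (by linarith)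
  · rw [preLift, coeffA_vec]
    have e : a * (a * Complex.normSq s + 2 * (conj b * s * conj r).re + d * Complex.normSq r)
        = Complex.normSq (a * s + b * r) + (a * d - Complex.normSq b) * Complex.normSq r := by
      simp only [Complex.normSq_apply, Complex.mul_re, Complex.mul_im, Complex.conj_re,
        Complex.conj_im, Complex.add_re, Complex.add_im, Complex.ofReal_re, Complex.ofReal_im]
      ring
    refine (pos_iff_pos_of_mul_pos (a := a) ?_).1 h1.2
    rw [e]
    by_cases hr : r = 0
    · subst hr
      have hs : s ≠ 0 := by rintro rfl; simp at hdet
      have ha : (a : ℂ) ≠ 0 := by exact_mod_cast h1.2.ne'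
      rw [mul_zero, add_zero, map_zero, mul_zero, add_zero]
      exact Complex.normSq_pos.2 (mul_ne_zero ha hs)
    · exact add_pos_of_nonneg_of_pos (Complex.normSq_nonneg _)
        (mul_pos (by linarith) (Complex.normSq_pos.2 hr))

/-- If `hermForm a' b' d'` and `hermForm a b d` correspond to each other under `M`, so do the
forms on the extended plane. -/
lemma exists_circleForm_holPerm_eq (M : GL (Fin 2) ℂ) {a : ℝ} {b : ℂ} {d a' : ℝ} {b' : ℂ} {d' : ℝ}
    {D : ℝ} (hD : 0 < D)
    (h2 : ∀ x y, hermForm a' b' d' (M 0 0 * x + M 0 1 * y) (M 1 0 * x + M 1 1 * y) =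
      D * hermForm a b d x y) (z : RiemannSphere) :
    ∃ k : ℝ, 0 < k ∧ circleForm a' b' d' (holPerm M z) = k * circleForm a b d z := by
  have hdet : M 0 0 * M 1 1 - M 0 1 * M 1 0 ≠ 0 := by
    simpa [Matrix.det_fin_two] using M.det_ne_zero
  have key : ∀ x y X Y : ℂ, X = M 0 0 * x + M 0 1 * y → Y = M 1 0 * x + M 1 1 * y →
      (x ≠ 0 ∨ y ≠ 0) →
      ∃ k : ℝ, 0 < k ∧
        (if Y = 0 then hermForm a' b' d' 1 0 else hermForm a' b' d' (X / Y) 1)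
          = k * hermForm a b d x y := by
    intro x y X Y hX hY hxy
    have h3 := h2 x y
    rw [← hX, ← hY] at h3
    split_ifs with hY0
    · have hX0 : X ≠ 0 := by
        intro hX0
        have e1 : (M 0 0 * M 1 1 - M 0 1 * M 1 0) * x = 0 := by
          linear_combination (-M 1 1) * hX + M 0 1 * hY + M 1 1 * hX0 - M 0 1 * hY0
        have e2 : (M 0 0 * M 1 1 - M 0 1 * M 1 0) * y = 0 := by
          linear_combination (M 1 0) * hX - M 0 0 * hY - M 1 0 * hX0 + M 0 0 * hY0
        rcases hxy with hx | hy
        · exact (mul_ne_zero hdet hx) e1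
        · exact (mul_ne_zero hdet hy) e2
      have hXp := Complex.normSq_pos.2 hX0
      refine ⟨D / Complex.normSq X, div_pos hD hXp, ?_⟩
      have h4 := hermForm_homogeneous a' b' d' X 1 0
      rw [one_mul, zero_mul] at h4
      rw [hY0, h4] at h3
      rw [div_mul_eq_mul_div, ← h3]
      field_simp
    · have hYp := Complex.normSq_pos.2 hY0
      refine ⟨D / Complex.normSq Y, div_pos hD hYp, ?_⟩
      have h4 := hermForm_homogeneous a' b' d' Y (X / Y) 1
      rw [one_mul, div_mul_cancel₀ _ hY0] at h4
      rw [h4] at h3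
      rw [div_mul_eq_mul_div, ← h3]
      field_simp
  cases z using OnePoint.rec with
  | infty =>
    obtain ⟨k, hk, e⟩ := key 1 0 (M 0 0) (M 1 0) (by simp) (by simp) (Or.inl one_ne_zero)
    refine ⟨k, hk, ?_⟩
    change circleForm a' b' d' (M • (∞ : OnePoint ℂ)) = k * hermForm a b d 1 0
    rw [← e, smul_infty_eq_ite]
    split_ifs <;> rfl
  | coe z =>
    obtain ⟨k, hk, e⟩ := key z 1 (M 0 0 * z + M 0 1) (M 1 0 * z + M 1 1) (by simp) (by simp)
      (Or.inr one_ne_zero)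
    refine ⟨k, hk, ?_⟩
    change circleForm a' b' d' (M • (z : OnePoint ℂ)) = k * hermForm a b d z 1
    rw [← e, smul_some_eq_ite]
    split_ifs <;> rfl

/-- The Lorentz transformation induced by a holomorphic Möbius transformation. -/
def liftHol (M : GL (Fin 2) ℂ) (x : Minkowski) : Minkowski :=
  ‖M 0 0 * M 1 1 - M 0 1 * M 1 0‖⁻¹ •
    preLift (M 0 0) (M 0 1) (M 1 0) (M 1 1) (coeffA x) (coeffB x) (coeffD x)

lemma isLift_holMoebius (M : GL (Fin 2) ℂ) : IsLift (holMoebius M) (liftHol M) := by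
  have hdet : M 0 0 * M 1 1 - M 0 1 * M 1 0 ≠ 0 := by
    simpa [Matrix.det_fin_two] using M.det_ne_zero
  have hn : 0 < ‖M 0 0 * M 1 1 - M 0 1 * M 1 0‖⁻¹ := by positivity
  refine ⟨fun x y => ?_, fun x hx => ?_, fun e z => ?_⟩
  · rw [liftHol, liftHol, lor_smul_left, lor_smul_right, lor_preLift, vec_coeff, vec_coeff,
      Complex.normSq_eq_norm_sq]
    field_simp
  · refine (isTimelike_preLift hdet ?_).smul hn
    rwa [vec_coeff]
  · obtain ⟨k, hk, h⟩ := exists_circleForm_holPerm_eq M (Complex.normSq_pos.2 hdet)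
      (hermForm_preLift _ _ _ _ (coeffA e) (coeffB e) (coeffD e)) z
    refine ⟨_, mul_pos hn hk, ?_⟩
    rw [liftHol, form_smul, mul_assoc]
    exact congrArg _ h

lemma exists_isLift (f : Moebius) : ∃ L, IsLift f L := by
  obtain ⟨f, M, rfl | rfl⟩ := f
  · exact ⟨_, isLift_holMoebius M⟩
  · exact ⟨_, (isLift_holMoebius M).mul isLift_conjMoebius⟩

lemma lor_normal_smul_smul (f : Moebius) (c c' : OrientedCircle) :
    lor (normal (f • c)) (normal (f • c')) = lor (normal c) (normal c') := by
  obtain ⟨L, hL⟩ := exists_isLift f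
  rw [hL.normal_smul, hL.normal_smul, hL.lor]

/-- The normals are all the unit spacelike vectors, and these span Minkowski space: any vector
becomes spacelike after adding a large multiple of a fixed spacelike one. -/
lemma eq_of_forall_lor_normal {x y : Minkowski}
    (h : ∀ c, lor x (normal c) = lor y (normal c)) : x = y := by
  have key : ∀ e : Minkowski, 0 < lor e e → lor x e = lor y e := by
    intro e he
    have hs := Real.sqrt_pos.2 he
    obtain ⟨c, hc⟩ := exists_normal_eq (e := (√(lor e e))⁻¹ • e) (by
      rw [lor_smul_left, lor_smul_right, ← mul_assoc, ← mul_inv, Real.mul_self_sqrt he.le,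
        inv_mul_cancel₀ he.ne'])
    have := h c
    rw [hc, lor_smul_right, lor_smul_right] at this
    exact mul_left_cancel₀ (inv_pos.2 hs).ne' this
  refine eq_of_forall_lor_eq fun z => ?_
  set v : Minkowski := vec 0 1 0 with hv
  have hvv : lor v v = 1 := by simp [hv, lor_vec_self]
  -- Large enough for `t ^ 2` to exceed `|lor z z| + 2 * t * |lor z v|`.
  set t := |lor z z| + 2 * |lor z v| + 1 with ht
  have h1 : 1 ≤ t := by
    have := abs_nonneg (lor z z); have := abs_nonneg (lor z v); linarith
  have h2 : 0 < lor (z + t • v) (z + t • v) := by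
    simp only [lor_add_left, lor_add_right, lor_smul_left, lor_smul_right, hvv, lor_comm v z]
    have h3 := neg_abs_le (lor z z)
    have h4 := neg_abs_le (lor z v)
    nlinarith [abs_nonneg (lor z z), abs_nonneg (lor z v)]
  have h5 := key _ h2
  rw [lor_add_right, lor_add_right, lor_smul_right, lor_smul_right, key v (by rw [hvv]; exact one_pos)]
    at h5
  linarith

/-- A Möbius transformation which fixes all circles is the identity. -/
lemma eq_one_of_forall_smul_eq {f : Moebius} (h : ∀ c : OrientedCircle, f • c = c) : f = 1 := by
  have hmem : ∀ (c : OrientedCircle) (z : RiemannSphere), f • z ∈ c.interior ↔ z ∈ c.interior := by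
    intro c z
    conv_lhs => rw [← h c]
    exact Set.smul_mem_smul_set_iff
  have hform : ∀ e z, lor e e = 1 → (form e (f • z) < 0 ↔ form e z < 0) := by
    intro e z he
    obtain ⟨c, rfl⟩ := exists_normal_eq he
    have := hmem c z
    rwa [(isNormalOf_normal c).interior] at this
  have hvec : ∀ a b d z, 0 < Complex.normSq b - a * d →
      (circleForm a b d (f • z) < 0 ↔ circleForm a b d z < 0) := by
    intro a b d z h0
    have hs := inv_pos.2 (Real.sqrt_pos.2 h0)
    have := hform ((√(Complex.normSq b - a * d))⁻¹ • vec a b d) z (by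
      rw [lor_smul_left, lor_smul_right, lor_vec_self, ← mul_assoc, ← mul_inv,
        Real.mul_self_sqrt h0.le, inv_mul_cancel₀ h0.ne'])
    rw [form_smul, form_smul, form_vec, form_vec] at this
    simpa only [mul_neg_iff, hs, hs.le.not_gt, true_and, false_and, or_false] using this
  -- The unit disc around `x` contains `x` but not `∞`; this rules out that `f` moves `∞` to a
  -- finite point or a finite point to `∞`.
  have hinfty : ∀ x : ℂ, circleForm 1 x (Complex.normSq x - 1) (x : RiemannSphere) < 0 := by
    intro x
    change hermForm _ _ _ _ _ < 0
    simp [hermForm, Complex.normSq_apply]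
    nlinarith
  refine Subtype.ext (Equiv.ext fun z => ?_)
  change f • z = z
  by_contra hne
  cases z using OnePoint.rec with
  | infty =>
    obtain ⟨x, hx⟩ := OnePoint.ne_infty_iff_exists.1 hne
    have := hvec 1 x (Complex.normSq x - 1) ∞ (by linarith)
    rw [← hx] at this
    have h1 := this.1 (hinfty x)
    change hermForm _ _ _ _ _ < 0 at h1
    simp [hermForm] at h1
    linarith
  | coe z =>
    by_cases hinf : f • (z : RiemannSphere) = ∞
    · have := hvec 1 z (Complex.normSq z - 1) z (by linarith)
      rw [hinf] at this
      have h1 := this.2 (hinfty z)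
      change hermForm _ _ _ _ _ < 0 at h1
      simp [hermForm] at h1
      linarith
    · obtain ⟨x, hx⟩ := OnePoint.ne_infty_iff_exists.1 hinf
      have hxz : x ≠ z := fun e => hne (by rw [← hx, e])
      have hpos := Complex.normSq_pos.2 (sub_ne_zero.2 hxz)
      -- The disc around `z` whose boundary passes through `x = f • z`: it contains `z` but not `x`.
      have := hvec 1 z (Complex.normSq z - Complex.normSq (x - z)) z (by linarith)
      rw [← hx] at this
      have h1 := this.2 (by
        change hermForm _ _ _ _ _ < 0
        simp only [hermForm, Complex.normSq_apply, Complex.mul_re, Complex.mul_im, Complex.conj_re,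
          Complex.conj_im, Complex.one_re, Complex.one_im] at hpos ⊢
        nlinarith)
      change hermForm _ _ _ _ _ < 0 at h1
      simp only [hermForm, Complex.normSq_apply, Complex.mul_re, Complex.mul_im, Complex.conj_re,
          Complex.conj_im, Complex.one_re, Complex.one_im, Complex.sub_re, Complex.sub_im] at h1
      nlinarith

lemma eq_of_forall_smul_eq {f g : Moebius} (h : ∀ c : OrientedCircle, f • c = g • c) : f = g := by
  rw [← inv_mul_eq_one]
  exact eq_one_of_forall_smul_eq fun c => by rw [mul_smul, ← h, inv_smul_smul]

/-! ### Reflections -/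

/-- The matrix of the reflection has the real determinant `-(|b|² - a d)`. Its normalized lift,
composed with conjugation, agrees coefficient by coefficient with the Lorentz reflection. -/
lemma normal_reflectionOfEquation_smul {a : ℝ} {b : ℂ} {d : ℝ} {c : OrientedCircle}
    (h : IsEquationOf a b d c.curve c.interior) (c' : OrientedCircle) :
    normal (reflectionOfEquation a b d h.1 • c') = lorReflect (normal c) (normal c') := by
  have h0 := h.1
  have hs : 0 < √(Complex.normSq b - a * d) := Real.sqrt_pos.2 h0
  rw [h.isNormalOf.normal_eq]
  have hL : IsLift (reflectionOfEquation a b d h0) _ :=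
    (isLift_holMoebius _).mul isLift_conjMoebius
  rw [hL.normal_smul]
  obtain ⟨a', b', d', e⟩ := exists_eq_vec (normal c')
  have edet : b * -conj b - -(d : ℂ) * a = ((-(Complex.normSq b - a * d) : ℝ) : ℂ) := by
    push_cast
    rw [← Complex.mul_conj]
    ring
  rw [e, Function.comp_apply, liftConj, liftHol]
  simp only [coeffA_vec, coeffB_vec, coeffD_vec]
  change ‖b * -conj b - -(d : ℂ) * a‖⁻¹ • preLift b (-(d : ℂ)) a (-conj b) a' (conj b') d' = _
  rw [edet, Complex.norm_real, Real.norm_eq_abs, abs_neg, abs_of_pos h0, inv_smul_eq_iff₀ h0.ne',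
    lorReflect, lor_smul_right, smul_smul, smul_sub, smul_smul]
  have e2 : (Complex.normSq b - a * d) * (2 * ((√(Complex.normSq b - a * d))⁻¹ *
      lor (vec a' b' d') (vec a b d)) * (√(Complex.normSq b - a * d))⁻¹) =
      2 * lor (vec a' b' d') (vec a b d) := by
    have := Real.sq_sqrt h0.le
    field_simp
    rw [this]
  rw [e2, lor_vec, smul_vec, smul_vec, preLift, vec_sub_vec]
  congr 1
  · simp only [Complex.normSq_apply, Complex.mul_re, Complex.mul_im, Complex.conj_re,
      Complex.conj_im, Complex.neg_re, Complex.neg_im, Complex.ofReal_re, Complex.ofReal_im]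
    ring
  · apply Complex.ext <;>
    · simp only [Complex.normSq_apply, Complex.mul_re, Complex.mul_im, Complex.conj_re,
        Complex.conj_im, Complex.neg_re, Complex.neg_im, Complex.ofReal_re, Complex.ofReal_im,
        Complex.add_re, Complex.add_im, Complex.sub_re, Complex.sub_im]
      ring
  · simp only [Complex.normSq_apply, Complex.mul_re, Complex.mul_im, Complex.conj_re,
      Complex.conj_im, Complex.neg_re, Complex.neg_im, Complex.ofReal_re, Complex.ofReal_im]
    ring

lemma normal_reflection_smul (c c' : OrientedCircle) :
    normal (reflection c • c') = lorReflect (normal c) (normal c') :=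
  normal_reflectionOfEquation_smul c.exists_equation.choose_spec.choose_spec.choose_spec c'

lemma reflection_mul_self (c : OrientedCircle) : reflection c * reflection c = 1 := by
  refine eq_one_of_forall_smul_eq fun c' => normal_injective ?_
  rw [mul_smul, normal_reflection_smul, normal_reflection_smul,
    lorReflect_lorReflect (lor_normal_self c)]

lemma reflection_inv (c : OrientedCircle) : (reflection c)⁻¹ = reflection c :=
  inv_eq_of_mul_eq_one_left (reflection_mul_self c)

lemma mul_reflection (f : Moebius) (c : OrientedCircle) :
    f * reflection c = reflection (f • c) * f := by
  refine eq_of_forall_smul_eq fun c' => normal_injective (eq_of_forall_lor_normal fun c'' => ?_)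
  rw [← smul_inv_smul f c'', mul_smul, mul_smul, lor_normal_smul_smul, normal_reflection_smul,
    normal_reflection_smul, lor_lorReflect_left, lor_lorReflect_left]
  simp only [lor_normal_smul_smul]

lemma mul_reflection_mul_inv (f : Moebius) (c : OrientedCircle) :
    f * reflection c * f⁻¹ = reflection (f • c) := by
  rw [mul_reflection, mul_inv_cancel_right]

/-- Reflections across orthogonal circles fix the other circle. -/
lemma reflection_smul_of_lor_eq_zero {c c' : OrientedCircle}
    (h : lor (normal c) (normal c') = 0) : reflection c • c' = c' :=
  normal_injective (by
    rw [normal_reflection_smul, lorReflect, lor_comm, h, mul_zero, zero_smul, sub_zero])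

lemma reflection_commute {c c' : OrientedCircle} (h : lor (normal c) (normal c') = 0) :
    reflection c * reflection c' = reflection c' * reflection c := by
  rw [mul_reflection, reflection_smul_of_lor_eq_zero h]

lemma normal_reflection_smul_self (c : OrientedCircle) :
    normal (reflection c • c) = -normal c := by
  rw [normal_reflection_smul, lorReflect, lor_normal_self, mul_one, two_smul]
  abel

lemma lor_normal_reflection_smul (x : Minkowski) (c c' : OrientedCircle) :
    lor (lorReflect (normal c) x) (normal (reflection c • c')) = lor x (normal c') := by
  rw [normal_reflection_smul, lor_lorReflect_lorReflect (lor_normal_self c)]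

/-- The points of hyperbolic space are moved by Möbius transformations. -/
lemma exists_isTimelike_lor_normal_smul (f : Moebius) {x : Minkowski} (hx : IsTimelike x) :
    ∃ y, IsTimelike y ∧ lor y y = lor x x ∧
      ∀ c, lor y (normal (f • c)) = lor x (normal c) := by
  obtain ⟨L, hL⟩ := exists_isLift f
  exact ⟨L x, hL.isTimelike x hx, hL.lor x x, fun c => by rw [hL.normal_smul, hL.lor]⟩

/-- Self-duality of the cone: if `n` were not causal, then `(n.1, s)`, with `s` slightly larger than
`‖n.1‖` or suitably scaled, would be timelike with nonnegative product with `n`. -/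
lemma isCausal_of_forall_lor_neg {n : Minkowski} (h : ∀ x, IsTimelike x → lor x n < 0) :
    IsCausal n := by
  by_contra hn
  have hn' : n.2 < ‖n.1‖ := not_le.1 hn
  have h0 : 0 ≤ ‖n.1‖ := norm_nonneg _
  obtain ⟨s, hs, hs'⟩ : ∃ s, ‖n.1‖ < s ∧ s * n.2 ≤ ‖n.1‖ ^ 2 := by
    rcases le_or_gt n.2 0 with h2 | h2
    · exact ⟨‖n.1‖ + 1, by linarith, by nlinarith⟩
    · refine ⟨‖n.1‖ ^ 2 / n.2, ?_, (div_mul_cancel₀ _ h2.ne').le⟩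
      rw [lt_div_iff₀ h2]
      nlinarith
  have := h (n.1, s) hs
  rw [lor, real_inner_self_eq_norm_sq] at this
  dsimp only at this
  linarith

/-- Separation is expressed by products with timelike vectors alone, and these are invariant under
Möbius transformations. -/
lemma AreSeparated.smul {c c' : OrientedCircle} (h : AreSeparated c c') (f : Moebius) :
    AreSeparated (f • c) (f • c') := by
  have key : ∀ x, IsTimelike x → lor x (normal (f • c) + normal (f • c')) < 0 := by
    intro x hx
    obtain ⟨y, hy, -, hyx⟩ := exists_isTimelike_lor_normal_smul f⁻¹ hx
    have h1 := hyx (f • c)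
    have h2 := hyx (f • c')
    rw [inv_smul_smul] at h1 h2
    rw [lor_add_right, ← h1, ← h2, ← lor_add_right, lor_comm]
    exact h.1.lor_neg h.2 hy
  refine ⟨isCausal_of_forall_lor_neg key, fun h0 => ?_⟩
  have := key _ isTimelike_zero_one
  rw [h0, lor_comm, lor_zero_left] at this
  exact this.false

/-! ### Word length -/

/-- `w` is a product of `n` reflections across circles in `E`. -/
inductive HasWord (E : Set OrientedCircle) : ℕ → Moebius → Prop
  | one : HasWord E 0 1
  | mul {s : OrientedCircle} {n : ℕ} {w : Moebius} (hs : s ∈ E) (hw : HasWord E n w) :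
      HasWord E (n + 1) (reflection s * w)

/-- The word length with respect to the reflections across circles in `E`. -/
def wordLength (E : Set OrientedCircle) (w : Moebius) : ℕ := sInf {n | HasWord E n w}

lemma reflection_mem_reflectionGroup {E : Set OrientedCircle} {s : OrientedCircle} (hs : s ∈ E) :
    reflection s ∈ reflectionGroup E :=
  Subgroup.subset_closure (mem_image_of_mem _ hs)

lemma HasWord.mem {E : Set OrientedCircle} {n : ℕ} {w : Moebius} (h : HasWord E n w) :
    w ∈ reflectionGroup E := by
  induction h with
  | one => exact one_mem _
  | mul hs _ ih => exact mul_mem (reflection_mem_reflectionGroup hs) ih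

lemma exists_hasWord {E : Set OrientedCircle} {w : Moebius} (hw : w ∈ reflectionGroup E) :
    ∃ n, HasWord E n w := by
  induction hw using Subgroup.closure_induction_left with
  | one => exact ⟨0, .one⟩
  | mul_left x hx y _ ih =>
    obtain ⟨s, hs, rfl⟩ := hx
    obtain ⟨n, hn⟩ := ih
    exact ⟨n + 1, hn.mul hs⟩
  | inv_mul_cancel x hx y _ ih =>
    obtain ⟨s, hs, rfl⟩ := hx
    obtain ⟨n, hn⟩ := ih
    rw [reflection_inv]
    exact ⟨n + 1, hn.mul hs⟩

lemma hasWord_wordLength {E : Set OrientedCircle} {w : Moebius} (hw : w ∈ reflectionGroup E) :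
    HasWord E (wordLength E w) w :=
  Nat.sInf_mem (exists_hasWord hw)

lemma HasWord.wordLength_le {E : Set OrientedCircle} {n : ℕ} {w : Moebius} (h : HasWord E n w) :
    wordLength E w ≤ n :=
  Nat.sInf_le h

lemma wordLength_mul_le {E : Set OrientedCircle} {s : OrientedCircle} (hs : s ∈ E) {w : Moebius}
    (hw : w ∈ reflectionGroup E) : wordLength E (reflection s * w) ≤ wordLength E w + 1 :=
  ((hasWord_wordLength hw).mul hs).wordLength_le

/-- The first letter of a shortest word is split off. This drives all inductions on word length. -/
lemma eq_one_or_exists_eq_mul {E : Set OrientedCircle} {w : Moebius}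
    (hw : w ∈ reflectionGroup E) :
    w = 1 ∨ ∃ s ∈ E, ∃ w' ∈ reflectionGroup E, w = reflection s * w' ∧
      wordLength E w = wordLength E w' + 1 := by
  have h := hasWord_wordLength hw
  generalize hn : wordLength E w = n at h
  cases h with
  | one => exact Or.inl rfl
  | @mul s n w' hs h =>
    refine Or.inr ⟨s, hs, w', h.mem, rfl, ?_⟩
    have := wordLength_mul_le hs h.mem
    have := h.wordLength_le
    omega

/-! ### Right-angled reflection groups -/

/-- The circles in `E` are pairwise orthogonal or separated. -/
def IsRightAngled (E : Set OrientedCircle) : Prop :=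
  E.Pairwise fun c c' => lor (normal c) (normal c') = 0 ∨ AreSeparated c c'

/-- The (cone over the) points of hyperbolic space which lie outside all half-spaces over the
interiors of the circles in `E`. -/
def chamber (E : Set OrientedCircle) : Set Minkowski :=
  {x | IsTimelike x ∧ ∀ c ∈ E, lor x (normal c) < 0}

/-- The closed chamber. -/
def closedChamber (E : Set OrientedCircle) : Set Minkowski :=
  {x | IsTimelike x ∧ ∀ c ∈ E, lor x (normal c) ≤ 0}

variable {E : Set OrientedCircle}

lemma add_smul_mem_chamber {q p : Minkowski} (hq : q ∈ closedChamber E) (hp : p ∈ chamber E)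
    {ε : ℝ} (hε : 0 < ε) : q + ε • p ∈ chamber E := by
  refine ⟨hq.1.add_isCausal (hp.1.smul hε).isCausal, fun c hc => ?_⟩
  rw [lor_add_left, lor_smul_left]
  have := hq.2 c hc
  have := mul_neg_of_pos_of_neg hε (hp.2 c hc)
  linarith

lemma lor_nonpos_of_mem_closedChamber {q p e : Minkowski} (hq : q ∈ closedChamber E)
    (hp : p ∈ chamber E) (h : ∀ x ∈ chamber E, lor x e < 0) : lor q e ≤ 0 := by
  by_contra hn
  have hn' := not_le.1 hn
  have h1 := h p hp
  have h2 := h _ (add_smul_mem_chamber hq hp (ε := lor q e / -lor p e) (div_pos hn' (by linarith)))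
  rw [lor_add_left, lor_smul_left] at h2
  have : lor q e / -lor p e * lor p e = -lor q e := by
    have := h1.ne
    field_simp
  linarith

lemma lor_normal_smul_reflection_smul_self (x : Minkowski) (f : Moebius) (c : OrientedCircle) :
    lor x (normal (f • reflection c • c)) = -lor x (normal (f • c)) := by
  rw [smul_smul, mul_reflection, mul_smul, normal_reflection_smul_self, lor_neg_right]

/-- The chamber lies on one side of each wall, and the side determines whether the reflection in
the wall shortens the word. -/
theorem lor_neg_or_lor_pos (hE : IsRightAngled E) {w : Moebius} (hw : w ∈ reflectionGroup E)
    {s : OrientedCircle} (hs : s ∈ E) :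
    (∀ p ∈ chamber E, lor p (normal (w⁻¹ • s)) < 0) ∨
      (∀ p ∈ chamber E, 0 < lor p (normal (w⁻¹ • s))) ∧
        wordLength E (reflection s * w) < wordLength E w := by
  induction hn : wordLength E w generalizing w s with
  | zero =>
    rcases eq_one_or_exists_eq_mul hw with rfl | ⟨t, ht, w', hw', -, h⟩
    · left
      intro p hp
      rw [inv_one, one_smul]
      exact hp.2 s hs
    · omega
  | succ n ih =>
    rcases eq_one_or_exists_eq_mul hw with rfl | ⟨t, ht, w', hw', rfl, h⟩
    · have := (HasWord.one (E := E)).wordLength_le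
      omega
    have hw'n : wordLength E w' = n := by omega
    have hinv : ∀ c : OrientedCircle, (reflection t * w')⁻¹ • c = w'⁻¹ • reflection t • c := by
      intro c
      rw [mul_inv_rev, reflection_inv, mul_smul]
    -- Since `t` is the first letter of a shortest word, the reflection in it lengthens `w'`; so the
    -- induction hypothesis for `w'` puts the chamber on the negative side of `w'⁻¹ • t`, and
    -- reflecting flips the sign.
    have hpos : ∀ p ∈ chamber E, 0 < lor p (normal ((reflection t * w')⁻¹ • t)) := by
      intro p hp
      rw [hinv, lor_normal_smul_reflection_smul_self, neg_pos]
      rcases ih hw' ht hw'n with h1 | ⟨-, h1⟩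
      · exact h1 p hp
      · omega
    by_cases hst : s = t
    · subst hst
      refine Or.inr ⟨hpos, ?_⟩
      rw [← mul_assoc, reflection_mul_self, one_mul]
      omega
    rcases hE ht hs (Ne.symm hst) with h0 | h0
    -- Orthogonal case: the reflection in `t` fixes `s`, so the wall is the one already treated for
    -- `w'`, and the two reflections commute in the length estimate.
    · simp only [hinv, reflection_smul_of_lor_eq_zero h0]
      rcases ih hw' hs hw'n with h1 | ⟨h1, h2⟩
      · exact Or.inl h1
      · refine Or.inr ⟨h1, ?_⟩
        rw [← mul_assoc, ← reflection_commute h0, mul_assoc]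
        have := wordLength_mul_le ht (mul_mem (reflection_mem_reflectionGroup hs) hw')
        omega
    -- Separated case: the chamber lies in the half-space over the translate of `t`, which is
    -- disjoint from the one over the translate of `s`.
    · exact Or.inl fun p hp => (h0.smul _).lor_neg hp.1 (hpos p hp).le

/-- No wall of the tessellation cuts the chamber, so one of its points decides the side. -/
lemma forall_lor_neg_of_lor_neg (hE : IsRightAngled E) {c : OrientedCircle}
    (hc : c ∈ orbitOf (reflectionGroup E) E) {p : Minkowski} (hp : p ∈ chamber E)
    (h : lor p (normal c) ≤ 0) : ∀ x ∈ chamber E, lor x (normal c) < 0 := by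
  obtain ⟨w, hw, s, hs, rfl⟩ := hc
  rcases lor_neg_or_lor_pos hE (inv_mem hw) hs with h1 | ⟨h1, -⟩
  · rwa [inv_inv] at h1
  · rw [inv_inv] at h1
    exact absurd (h1 p hp) h.not_gt

/-- The reflection group acts freely on the chambers. -/
theorem eq_one_of_forall_inv_smul_mem (hE : IsRightAngled E) (hne : (chamber E).Nonempty)
    {w : Moebius} (hw : w ∈ reflectionGroup E) (h : ∀ c ∈ E, w⁻¹ • c ∈ E) : w = 1 := by
  rcases eq_one_or_exists_eq_mul hw with h1 | ⟨s, hs, w', hw', rfl, hl⟩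
  · exact h1
  obtain ⟨p, hp⟩ := hne
  -- If `s` is the first letter of a shortest word for `w`, the chamber is on the positive side of
  -- `w⁻¹ • s`; as a member of `E` this circle has the chamber on its negative side.
  have h1 := hp.2 _ (h s hs)
  rcases lor_neg_or_lor_pos hE hw' hs with h2 | ⟨-, h2⟩
  · have := h2 p hp
    rw [mul_inv_rev, reflection_inv, mul_smul, lor_normal_smul_reflection_smul_self] at h1
    linarith
  · omega

/-- Each wall of the chamber is a facet. -/
lemma exists_facet_point (hE : IsRightAngled E) {p : Minkowski} (hp : p ∈ chamber E)
    {c : OrientedCircle} (hc : c ∈ E) :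
    ∃ q, IsTimelike q ∧ lor q (normal c) = 0 ∧ ∀ c' ∈ E, c' ≠ c → lor q (normal c') < 0 := by
  have hQ := (isTimelike_iff.1 hp.1).1
  -- The orthogonal projection of `p` to the wall. As distinct normals have nonpositive products, it
  -- remains on the negative side of the other walls.
  refine ⟨p - lor p (normal c) • normal c, ?_, ?_, fun c' hc' hne => ?_⟩
  · refine isTimelike_of_lor_neg (y := p) ?_ hp.1.isCausal ?_ <;>
    · simp only [lor_sub_left, lor_smul_left, lor_sub_right, lor_smul_right, lor_normal_self,
        lor_comm (normal c) p]
      nlinarith [sq_nonneg (lor p (normal c))]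
  · rw [lor_sub_left, lor_smul_left, lor_normal_self]; ring
  · rw [lor_sub_left, lor_smul_left]
    have h1 := hp.2 c hc
    have h2 := hp.2 c' hc'
    rcases hE hc hc' hne.symm with h0 | h0
    · rw [h0]; linarith
    · have := h0.lor_le
      nlinarith

/-- Two circles of `E` in the same orbit of the reflection group are equal. -/
theorem eq_of_smul_eq (hE : IsRightAngled E) (hne : (chamber E).Nonempty) {w : Moebius}
    (hw : w ∈ reflectionGroup E) {c d : OrientedCircle} (hc : c ∈ E) (hd : d ∈ E)
    (h : w • c = d) : c = d := by
  induction hn : wordLength E w using Nat.strong_induction_on generalizing w with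
  | _ n ih =>
    rcases eq_one_or_exists_eq_mul hw with rfl | ⟨s, hs, w', hw', hww, hl⟩
    · rwa [one_smul] at h
    have hwd : w⁻¹ • d = c := by rw [← h, inv_smul_smul]
    have hinv : ∀ c : OrientedCircle, w⁻¹ • c = w'⁻¹ • reflection s • c := by
      intro c
      rw [hww, mul_inv_rev, reflection_inv, mul_smul]
    have hpos : ∀ p ∈ chamber E, 0 < lor p (normal (w⁻¹ • s)) := by
      intro p hp
      rw [hinv, lor_normal_smul_reflection_smul_self, neg_pos]
      rcases lor_neg_or_lor_pos hE hw' hs with h1 | ⟨-, h1⟩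
      · exact h1 p hp
      · rw [← hww] at h1; omega
    obtain ⟨p, hp⟩ := hne
    -- The wall `w⁻¹ • d = c` has the chamber on its negative side, unlike `w⁻¹ • s`, so `s ≠ d`. If
    -- `s` and `d` are orthogonal, the letter `s` can be dropped.
    by_cases hsd : s = d
    · have h1 := hpos p hp
      rw [hsd, hwd] at h1
      exact absurd (hp.2 c hc) h1.not_gt
    rcases hE hs hd hsd with h0 | h0
    · refine ih _ (by omega) hw' ?_ rfl
      rw [hww, mul_smul, smul_eq_iff_eq_inv_smul, reflection_inv,
        reflection_smul_of_lor_eq_zero h0] at h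
      exact h
    -- If `s` and `d` are separated, a point on the facet of `c` lies in the closed half-space over
    -- `w⁻¹ • s`, hence strictly outside the one over `w⁻¹ • d = c`, although it is on that wall.
    · obtain ⟨q, hq, hq0, hqE⟩ := exists_facet_point hE hp hc
      have hqc : q ∈ closedChamber E := ⟨hq, fun c' hc' => by
        by_cases e : c' = c
        · rw [e, hq0]
        · exact (hqE c' hc' e).le⟩
      have h1 := lor_nonpos_of_mem_closedChamber (e := -normal (w⁻¹ • s)) hqc hp fun x hx => by
        rw [lor_neg_right]; linarith [hpos x hx]
      rw [lor_neg_right] at h1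
      have h2 := (h0.smul w⁻¹).lor_neg hq (by linarith)
      rw [hwd, hq0] at h2
      exact absurd h2 (lt_irrefl 0)

/-! ### Local finiteness and the tessellation of hyperbolic space -/

/-- Only finitely many of the half-spaces over the circles in `E` meet a given ball. -/
def IsLocallyFinite (E : Set OrientedCircle) : Prop := ∀ R : ℝ, {c ∈ E | (normal c).2 ≤ R}.Finite

-- Circles with large time coordinate are negative uniformly near `z` by `lor_neg_of_lt_snd`; the
-- finitely many others are handled by continuity.
open Filter Topology in
lemma IsLocallyFinite.eventually_lor_neg (hE : IsLocallyFinite E) {z : Minkowski}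
    (hz : IsTimelike z) :
    ∀ᶠ x in 𝓝 z, ∀ c ∈ E, lor z (normal c) < 0 → lor x (normal c) < 0 := by
  have hz' : ‖z.1‖ < z.2 := hz
  set r := ‖z.1‖ + 1
  set δ := (z.2 - ‖z.1‖) / 2 with hδ
  have hδ0 : 0 < δ := by linarith
  have h1 : ∀ᶠ x in 𝓝 z, ∀ c ∈ {c ∈ E | (normal c).2 ≤ r / δ},
      lor z (normal c) < 0 → lor x (normal c) < 0 := by
    refine (eventually_all_finite (hE _)).2 fun c _ => ?_
    by_cases h : lor z (normal c) < 0
    · have hc : Continuous fun x => lor x (normal c) := by fun_prop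
      filter_upwards [hc.continuousAt.eventually_lt continuousAt_const h] with x hx _ using hx
    · exact Eventually.of_forall fun x hx => absurd hx h
  have c1 : Continuous fun x : Minkowski => ‖x.1‖ := by fun_prop
  have c2 : Continuous fun x : Minkowski => ‖x.1‖ + δ := by fun_prop
  filter_upwards [h1, c1.continuousAt.eventually_lt continuousAt_const
    (show ‖z.1‖ < r by simp [r]), c2.continuousAt.eventually_lt continuous_snd.continuousAt
    (show ‖z.1‖ + δ < z.2 by linarith)] with x hx1 hx2 hx3 c hc hzc
  by_cases h : (normal c).2 ≤ r / δ
  · exact hx1 c ⟨hc, h⟩ hzc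
  · exact lor_neg_of_lt_snd (lor_normal_self c) hδ0 hx2.le hx3.le (not_le.1 h)

lemma IsLocallyFinite.finite_lor_nonneg (hE : IsLocallyFinite E) {z : Minkowski}
    (hz : IsTimelike z) : {c ∈ E | 0 ≤ lor z (normal c)}.Finite := by
  have hz' : ‖z.1‖ < z.2 := hz
  refine (hE (‖z.1‖ / (z.2 - ‖z.1‖))).subset fun c hc => ⟨hc.1, ?_⟩
  by_contra hn
  exact hc.2.not_gt (lor_neg_of_lt_snd (lor_normal_self c) (by linarith) le_rfl (by linarith)
    (not_le.1 hn))

/-- The points in the orbit of `y` under the reflection group. -/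
def pointOrbit (E : Set OrientedCircle) (y : Minkowski) : Set Minkowski :=
  {x | IsTimelike x ∧ lor x x = lor y y ∧
    ∃ w ∈ reflectionGroup E, ∀ c, lor x (normal (w • c)) = lor y (normal c)}

lemma lorReflect_mem_pointOrbit {y x : Minkowski} (hx : x ∈ pointOrbit E y) {s : OrientedCircle}
    (hs : s ∈ E) : lorReflect (normal s) x ∈ pointOrbit E y := by
  obtain ⟨h1, h2, w, hw, h3⟩ := hx
  refine ⟨lorReflect_isTimelike (lor_normal_self s) h1, ?_, reflection s * w,
    mul_mem (reflection_mem_reflectionGroup hs) hw, fun c => ?_⟩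
  · rw [lor_lorReflect_lorReflect (lor_normal_self s), h2]
  · rw [mul_smul, lor_normal_reflection_smul, h3]

/-- A closed hyperbolic ball around `p`. By Cauchy–Schwarz `-lor p x` is at least `(p.2 - ‖p.1‖) *
x.2`, so the time coordinate is bounded. -/
lemma isCompact_lor_ball {p : Minkowski} (hp : IsTimelike p) (m C : ℝ) (hm : m < 0) :
    IsCompact {x : Minkowski | lor x x = m ∧ 0 ≤ x.2 ∧ -lor p x ≤ C} := by
  have hp' : ‖p.1‖ < p.2 := hp
  refine (isCompact_closedBall (0 : Minkowski) (C / (p.2 - ‖p.1‖))).of_isClosed_subset ?_ ?_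
  · have h1 : IsClosed {x : Minkowski | lor x x = m} :=
      isClosed_eq (continuous_lor continuous_id continuous_id) continuous_const
    have h2 : IsClosed {x : Minkowski | 0 ≤ x.2} := isClosed_le continuous_const continuous_snd
    have h3 : IsClosed {x : Minkowski | -lor p x ≤ C} :=
      isClosed_le (continuous_lor continuous_const continuous_id).neg continuous_const
    exact h1.inter (h2.inter h3)
  · rintro x ⟨h1, h2, h3⟩
    have hx : ‖x.1‖ ≤ x.2 := by
      rw [lor_self] at h1
      exact le_of_pow_le_pow_left₀ two_ne_zero h2 (by linarith)
    have h4 : x.2 ≤ C / (p.2 - ‖p.1‖) := by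
      rw [le_div_iff₀ (by linarith)]
      have := real_inner_le_norm p.1 x.1
      have := mul_le_mul_of_nonneg_left hx (norm_nonneg p.1)
      unfold lor at h3
      linarith
    rw [mem_closedBall_zero_iff, Prod.norm_def, Real.norm_of_nonneg h2]
    exact max_le (hx.trans h4) h4

open Filter Topology in
/-- Reflections across pairwise orthogonal walls through `z` move a point of the orbit near `z`
to the closed chamber of these walls. -/
lemma exists_mem_pointOrbit_inter (F : Finset OrientedCircle) {y z : Minkowski}
    (hz : z ∈ closure (pointOrbit E y)) (hF : ∀ c ∈ F, c ∈ E) (hFz : ∀ c ∈ F, lor z (normal c) = 0)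
    (hort : (F : Set OrientedCircle).Pairwise fun c c' => lor (normal c) (normal c') = 0)
    {U : Set Minkowski} (hU : U ∈ 𝓝 z) :
    ∃ x ∈ pointOrbit E y, x ∈ U ∧ ∀ c ∈ F, lor x (normal c) ≤ 0 := by
  induction F using Finset.cons_induction generalizing U with
  | empty =>
    obtain ⟨x, hx, hxO⟩ := mem_closure_iff_nhds.1 hz U hU
    exact ⟨x, hxO, hx, by simp⟩
  | cons s F hsF ih =>
    have hfix : lorReflect (normal s) z = z := by
      rw [lorReflect, hFz s (Finset.mem_cons_self s F)]; simp
    have hU' : lorReflect (normal s) ⁻¹' U ∈ 𝓝 z :=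
      (continuous_lorReflect (normal s)).continuousAt.preimage_mem_nhds (by rwa [hfix])
    obtain ⟨x, hxO, hxU, hx⟩ := ih (fun c hc => hF c (Finset.mem_cons_of_mem hc))
      (fun c hc => hFz c (Finset.mem_cons_of_mem hc))
      (hort.mono (by simp [Finset.coe_cons])) (inter_mem hU hU')
    -- If `x` is on the wrong side of `s` it is reflected. Both the point and its mirror image are
    -- in `U`, and orthogonality leaves the products with the other normals unchanged.
    by_cases h : lor x (normal s) ≤ 0
    · exact ⟨x, hxO, hxU.1, by simpa using ⟨h, hx⟩⟩
    · refine ⟨_, lorReflect_mem_pointOrbit hxO (hF s (Finset.mem_cons_self s F)), hxU.2, ?_⟩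
      intro c hc
      rw [lor_lorReflect_left]
      rcases Finset.mem_cons.1 hc with rfl | hc'
      · rw [lor_normal_self]; linarith
      · have hne : s ≠ c := fun e => hsF (e ▸ hc')
        rw [hort (Finset.mem_coe.2 (Finset.mem_cons_self s F)) (Finset.mem_coe.2 hc) hne, mul_zero,
          sub_zero]
        exact hx c hc'

/-- The closed chambers cover hyperbolic space. -/
theorem exists_mem_closedChamber (hE : IsRightAngled E) (hf : IsLocallyFinite E) {p y : Minkowski}
    (hp : p ∈ chamber E) (hy : IsTimelike y) :
    ∃ w ∈ reflectionGroup E, ∃ x ∈ closedChamber E,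
      ∀ c, lor x (normal (w • c)) = lor y (normal c) := by
  have hm := (isTimelike_iff.1 hy).1
  have hyO : y ∈ pointOrbit E y := ⟨hy, rfl, 1, one_mem _, fun c => by rw [one_smul]⟩
  have hcl : ∀ x ∈ closure (pointOrbit E y), lor x x = lor y y ∧ 0 ≤ x.2 := by
    refine fun x hx => closure_minimal (t := {x | lor x x = lor y y ∧ 0 ≤ x.2}) ?_ ?_ hx
    · exact fun x hx => ⟨hx.2.1, (isTimelike_iff.1 hx.1).2.le⟩
    · exact (isClosed_eq (continuous_lor continuous_id continuous_id) continuous_const).inter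
        (isClosed_le continuous_const continuous_snd)
  have hrefl : ∀ s ∈ E, ∀ x ∈ closure (pointOrbit E y),
      lorReflect (normal s) x ∈ closure (pointOrbit E y) := fun s hs =>
    MapsTo.closure (fun x hx => lorReflect_mem_pointOrbit hx hs)
      (continuous_lorReflect (normal s))
  have hcont : Continuous fun x => -lor p x :=
    (continuous_lor continuous_const continuous_id).neg
  have hK : IsCompact (closure (pointOrbit E y) ∩ {x | -lor p x ≤ -lor p y}) :=
    (isCompact_lor_ball hp.1 (lor y y) (-lor p y) hm).of_isClosed_subset
      (isClosed_closure.inter (isClosed_le hcont continuous_const))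
      fun x hx => ⟨(hcl x hx.1).1, (hcl x hx.1).2, hx.2⟩
  -- `-lor p x` increases with the hyperbolic distance from `p`, so `z` is a point nearest to `p` in
  -- the closure of the orbit. It need not be known to lie in the orbit itself.
  obtain ⟨z, ⟨hzO, hzy⟩, hmin⟩ := hK.exists_isMinOn ⟨y, subset_closure hyO, le_refl (-lor p y)⟩
    hcont.continuousOn
  have hzt : IsTimelike z := by
    obtain ⟨h1, h2⟩ := hcl z hzO
    refine isTimelike_iff.2 ⟨by linarith, h2.lt_of_ne fun h0 => ?_⟩
    rw [lor_self, ← h0] at h1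
    nlinarith [sq_nonneg ‖z.1‖]
  have hzE : ∀ s ∈ E, lor z (normal s) ≤ 0 := by
    intro s hs
    by_contra hn
    -- Reflecting a point beyond the wall `s` to the side of `p` brings it closer to `p`.
    have h1 : -lor p (lorReflect (normal s) z) < -lor p z := by
      rw [lor_comm, lor_lorReflect_left, lor_comm (normal s) p, lor_comm z p]
      nlinarith [hp.2 s hs]
    have h2 := hmin (a := lorReflect (normal s) z)
      ⟨hrefl s hs z hzO, h1.le.trans hzy⟩
    exact h1.not_ge h2
  have hfin := hf.finite_lor_nonneg hzt
  -- The walls through `z` are finite in number and pairwise orthogonal. Reflections in them move an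
  -- orbit point near `z` to the right side of each; the other walls are respected by all points
  -- near `z`.
  obtain ⟨x, hxO, hxU, hx⟩ := exists_mem_pointOrbit_inter hfin.toFinset hzO
    (fun c hc => (hfin.mem_toFinset.1 hc).1)
    (fun c hc => le_antisymm (hzE c (hfin.mem_toFinset.1 hc).1) (hfin.mem_toFinset.1 hc).2)
    (fun c hc c' hc' hne => by
      rw [hfin.coe_toFinset] at hc hc'
      refine (hE hc.1 hc'.1 hne).resolve_right fun h => ?_
      exact (h.lor_neg hzt hc.2).not_ge hc'.2)
    (hf.eventually_lor_neg hzt)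
  obtain ⟨hxt, -, w, hw, hxw⟩ := hxO
  refine ⟨w, hw, x, ⟨hxt, fun c hc => ?_⟩, hxw⟩
  by_cases h : lor z (normal c) < 0
  · exact (hxU c hc h).le
  · exact hx c (hfin.mem_toFinset.2 ⟨hc, not_lt.1 h⟩)

/-! ### Symmetries of the tessellation -/

/-- Inclusion of linear half-spaces forces the two functionals to have the same kernel, hence to be
proportional, with a positive factor; the normalization makes that factor `1`. -/
lemma eq_of_forall_lor_neg_imp {e f : Minkowski} (he : lor e e = 1) (hf : lor f f = 1)
    (h : ∀ x, lor x e < 0 → lor x f < 0) : f = e := by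
  have hβ : 0 < lor e f := by
    have := h (-e) (by rw [lor_neg_left, he]; norm_num)
    rw [lor_neg_left] at this
    linarith
  have h0 : ∀ y, lor y e = 0 → lor y f ≤ 0 := by
    intro y hy
    by_contra hn
    have hn' := not_le.1 hn
    have := h ((lor e f / lor y f) • y - e) (by
      rw [lor_sub_left, lor_smul_left, hy, he]; norm_num)
    rw [lor_sub_left, lor_smul_left, div_mul_cancel₀ _ hn'.ne', sub_self] at this
    exact this.false
  have h1 : ∀ y, lor y e = 0 → lor y f = 0 := by
    intro y hy
    have := h0 (-y) (by rw [lor_neg_left, hy, neg_zero])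
    rw [lor_neg_left] at this
    linarith [h0 y hy]
  have h2 : f = lor e f • e := by
    refine eq_of_forall_lor_eq fun z => ?_
    have := h1 (z - lor z e • e) (by rw [lor_sub_left, lor_smul_left, he]; ring)
    rw [lor_sub_left, lor_smul_left] at this
    rw [lor_smul_left, lor_comm f, lor_comm e z]
    linarith
  have h3 : lor e f = 1 := by
    have : lor f f = lor e f * lor e f := by
      nth_rewrite 1 [h2]
      rw [lor_smul_left]
    nlinarith
  rw [h2, h3, one_smul]

/-- The vectors `x` and `x'` stand for the images of `p` and `p'` under `h`. The preimage under `h`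
of a wall does not cut the chamber, so a single image in the closed chamber brings the images of all
chamber points into the open chamber. -/
lemma mem_chamber_of_lor_eq (hE : IsRightAngled E) {h : Moebius}
    (hh : ∀ c ∈ orbitOf (reflectionGroup E) E, h⁻¹ • c ∈ orbitOf (reflectionGroup E) E)
    {p x : Minkowski} (hp : p ∈ chamber E) (hx : x ∈ closedChamber E)
    (hpx : ∀ c, lor x (normal (h • c)) = lor p (normal c)) {p' x' : Minkowski}
    (hp' : p' ∈ chamber E) (hx' : IsTimelike x')
    (hpx' : ∀ c, lor x' (normal (h • c)) = lor p' (normal c)) : x' ∈ chamber E := by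
  refine ⟨hx', fun c hc => ?_⟩
  have h1 := hpx' (h⁻¹ • c)
  have h2 := hpx (h⁻¹ • c)
  rw [smul_inv_smul] at h1 h2
  rw [h1]
  exact forall_lor_neg_of_lor_neg hE (hh c ⟨1, one_mem _, c, hc, (one_smul _ c).symm⟩) hp
    (h2 ▸ hx.2 c hc) p' hp'

/-- A symmetry of the tessellation which preserves the chamber permutes its walls. -/
theorem smul_mem_of_lor_eq (hE : IsRightAngled E) (hf : IsLocallyFinite E) {h : Moebius}
    (hh : ∀ c ∈ orbitOf (reflectionGroup E) E, h • c ∈ orbitOf (reflectionGroup E) E)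
    (hh' : ∀ c ∈ orbitOf (reflectionGroup E) E, h⁻¹ • c ∈ orbitOf (reflectionGroup E) E)
    {p x : Minkowski} (hp : p ∈ chamber E) (hx : x ∈ closedChamber E)
    (hpx : ∀ c, lor x (normal (h • c)) = lor p (normal c)) {e : OrientedCircle} (he : e ∈ E) :
    h • e ∈ E := by
  obtain ⟨q, hq, hq0, hqE⟩ := exists_facet_point hE hp he
  obtain ⟨q', hq', -, hqq⟩ := exists_isTimelike_lor_normal_smul h hq
  have hxC : x ∈ chamber E := mem_chamber_of_lor_eq hE hh' hp hx hpx hp hx.1 hpx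
  -- Otherwise the image `q'` of the facet point would be inside the chamber, and so would `q` by
  -- applying `h⁻¹`; but `q` lies on the wall `e`.
  obtain ⟨e', he', h1⟩ : ∃ e' ∈ E, 0 ≤ lor q (normal (h⁻¹ • e')) := by
    by_contra! hn
    have hq'C : q' ∈ chamber E := ⟨hq', fun c hc => by
      have := hqq (h⁻¹ • c)
      rw [smul_inv_smul] at this
      exact this ▸ hn c hc⟩
    have := mem_chamber_of_lor_eq (h := h⁻¹) hE (by simpa using hh) hxC
      ⟨hp.1, fun c hc => (hp.2 c hc).le⟩ (fun c => by rw [← hpx, smul_inv_smul]) hq'C hq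
      (fun c => by rw [← hqq, smul_inv_smul])
    exact (this.2 e he).ne hq0
  have hneg : ∀ p' ∈ chamber E, lor p' (normal (h⁻¹ • e')) < 0 := by
    refine forall_lor_neg_of_lor_neg hE (hh' e' ⟨1, one_mem _, e', he', (one_smul _ e').symm⟩) hp ?_
    have := hpx (h⁻¹ • e')
    rw [smul_inv_smul] at this
    exact this ▸ hx.2 e' he'
  -- Near `q` the chamber coincides with the half-space `lor x (normal e) < 0`, and it lies on the
  -- negative side of `h⁻¹ • e'` while `q` does not.
  have h2 : normal (h⁻¹ • e') = normal e := by
    refine eq_of_forall_lor_neg_imp (lor_normal_self _) (lor_normal_self _) fun y hy => ?_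
    have hcont : Continuous fun ε : ℝ => q + ε • y := by fun_prop
    have hlim : Filter.Tendsto (fun ε : ℝ => q + ε • y) (nhdsWithin 0 (Ioi 0)) (nhds q) := by
      have := hcont.tendsto 0
      simp only [zero_smul, add_zero] at this
      exact this.mono_left nhdsWithin_le_nhds
    obtain ⟨ε, ⟨hε1, hε2⟩, hε⟩ := ((hlim.eventually
      ((hf.eventually_lor_neg hq).and (isOpen_isTimelike.eventually_mem hq))).and
        self_mem_nhdsWithin).exists
    have hε' : 0 < ε := hε
    have := hneg (q + ε • y) ⟨hε2, fun c hc => by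
      by_cases hce : c = e
      · rw [hce, lor_add_left, hq0, lor_smul_left, zero_add]
        exact mul_neg_of_pos_of_neg hε' hy
      · exact hε1 c hc (hqE c hc hce)⟩
    rw [lor_add_left, lor_smul_left] at this
    by_contra hn
    nlinarith [mul_nonneg hε'.le (not_lt.1 hn)]
  rw [← normal_injective h2, smul_inv_smul]
  exact he'

/-! ### The chamber of a base configuration and its dual -/

lemma isLocallyFinite_of_pairwise {B : Set OrientedCircle} (hB : B.Pairwise AreSeparated) :
    IsLocallyFinite B := by
  intro R
  have h := finite_setOf_snd_le (S := normal '' B)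
    (by rintro _ ⟨c, -, rfl⟩; exact lor_normal_self c)
    (by
      rintro _ ⟨c, hc, rfl⟩ _ ⟨c', hc', rfl⟩ hne
      exact (hB hc hc' fun e => hne (congrArg normal e)).1) R
  exact (h.preimage normal_injective.injOn).subset fun c hc => ⟨mem_image_of_mem _ hc.1, hc.2⟩

lemma IsLocallyFinite.union {E F : Set OrientedCircle} (hE : IsLocallyFinite E)
    (hF : IsLocallyFinite F) : IsLocallyFinite (E ∪ F) := by
  intro R
  refine ((hE R).union (hF R)).subset ?_
  rintro c ⟨hc | hc, h⟩
  · exact Or.inl ⟨hc, h⟩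
  · exact Or.inr ⟨hc, h⟩

lemma IsRightAngled.lor_nonpos {E : Set OrientedCircle} (hE : IsRightAngled E)
    {c c' : OrientedCircle} (hc : c ∈ E) (hc' : c' ∈ E) (hne : c ≠ c') :
    lor (normal c) (normal c') ≤ 0 := by
  rcases hE hc hc' hne with h | h
  · exact h.le
  · linarith [h.lor_le]

/-- The only positive contributions are the squares `1` of `c` and `c'` themselves, and the product
of the two normals, at most `-1`, compensates them. -/
lemma IsRightAngled.lor_add_nonpos {E : Set OrientedCircle} (hE : IsRightAngled E)
    {c c' : OrientedCircle} (hc : c ∈ E) (hc' : c' ∈ E) (h : AreSeparated c c')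
    {e : OrientedCircle} (he : e ∈ E) : lor (normal c + normal c') (normal e) ≤ 0 := by
  have h1 := h.lor_le
  rw [lor_add_left]
  by_cases h2 : c = e
  · subst h2
    rw [lor_normal_self, lor_comm]
    linarith
  by_cases h3 : c' = e
  · subst h3
    rw [lor_normal_self]
    linarith
  linarith [hE.lor_nonpos hc he h2, hE.lor_nonpos hc' he h3]

open Filter in
/-- A causal vector in the closure of the chamber can be moved into the chamber. -/
lemma chamber_nonempty_of_isTimelike_add_smul {E : Set OrientedCircle} (hf : IsLocallyFinite E)
    {n t : Minkowski} (hn : IsCausal n) (hnE : ∀ c ∈ E, lor n (normal c) ≤ 0)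
    (ht : ∀ c ∈ E, lor n (normal c) = 0 → lor t (normal c) < 0) {N : ℝ}
    (hN : IsTimelike (t + N • n)) : (chamber E).Nonempty := by
  -- Only finitely many circles fail to be negative on `t + N • n`. On these `n` is strictly
  -- negative by the choice of `t`, so adding a large multiple of `n` repairs them.
  have h1 : ∀ᶠ k : ℝ in atTop, ∀ c ∈ {c ∈ E | 0 ≤ lor (t + N • n) (normal c)},
      lor (t + N • n) (normal c) + k * lor n (normal c) < 0 := by
    refine (eventually_all_finite (hf.finite_lor_nonneg hN)).2 fun c hc => ?_
    have hlt : lor n (normal c) < 0 := by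
      refine (hnE c hc.1).lt_of_ne fun h0 => ?_
      have h2 := hc.2
      rw [lor_add_left, lor_smul_left, h0, mul_zero, add_zero] at h2
      exact h2.not_gt (ht c hc.1 h0)
    filter_upwards [eventually_gt_atTop (lor (t + N • n) (normal c) / -lor n (normal c))] with k hk
    rw [div_lt_iff₀ (by linarith)] at hk
    linarith
  obtain ⟨k, hk, hk0⟩ := (h1.and (eventually_ge_atTop 0)).exists
  refine ⟨t + N • n + k • n, hN.add_isCausal (hn.smul hk0), fun c hc => ?_⟩
  rw [lor_add_left _ (k • n), lor_smul_left]
  by_cases h : 0 ≤ lor (t + N • n) (normal c)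
  · exact hk c ⟨hc, h⟩
  · linarith [mul_nonpos_of_nonneg_of_nonpos hk0 (hnE c hc)]

lemma IsTimelike.exists_isTimelike_add_smul {n : Minkowski} (hn : IsTimelike n) (t : Minkowski) :
    ∃ N : ℝ, IsTimelike (t + N • n) := by
  have hn' : 0 < n.2 - ‖n.1‖ := sub_pos.2 hn
  refine ⟨(‖t.1‖ + |t.2| + 1) / (n.2 - ‖n.1‖), ?_⟩
  set N := (‖t.1‖ + |t.2| + 1) / (n.2 - ‖n.1‖)
  have hN : 0 ≤ N := by positivity
  have h1 : N * (n.2 - ‖n.1‖) = ‖t.1‖ + |t.2| + 1 := div_mul_cancel₀ _ hn'.ne'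
  have h2 := norm_add_le t.1 (N • n.1)
  rw [norm_smul, Real.norm_of_nonneg hN] at h2
  simp only [IsTimelike, Prod.fst_add, Prod.snd_add, Prod.smul_fst, Prod.smul_snd, smul_eq_mul]
  linarith [neg_abs_le t.2]

/-- A point of hyperbolic space in the closed chamber can be moved into the chamber. -/
lemma chamber_nonempty_of_closedChamber {E : Set OrientedCircle} (hE : IsRightAngled E)
    (hf : IsLocallyFinite E) {n : Minkowski} (hn : n ∈ closedChamber E) :
    (chamber E).Nonempty := by
  have hfin := hf.finite_lor_nonneg hn.1
  -- The walls through `n` are pairwise orthogonal, so `t` has product `-1` with the normal of each.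
  set t : Minkowski := -∑ c ∈ hfin.toFinset, normal c with ht
  obtain ⟨N, hN⟩ := hn.1.exists_isTimelike_add_smul t
  refine chamber_nonempty_of_isTimelike_add_smul hf hn.1.isCausal hn.2 (fun c hc h0 => ?_) hN
  rw [ht, lor_neg_left, lor_sum_left, Finset.sum_eq_single c, lor_normal_self]
  · norm_num
  · intro c' hc' hne
    rw [hfin.mem_toFinset] at hc'
    refine (hE hc'.1 hc hne).resolve_right fun h => ?_
    exact (h.lor_neg hn.1 hc'.2).ne h0
  · exact fun h => absurd (hfin.mem_toFinset.2 ⟨hc, h0.ge⟩) h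

lemma IsCausal.lor_self_eq_zero {n : Minkowski} (hn : IsCausal n) (h : ¬ IsTimelike n) :
    lor n n = 0 := by
  have : ‖n.1‖ = n.2 := le_antisymm hn (not_lt.1 h)
  rw [lor_self, this, sub_self]

/-- The circles in `B` and those in `B'` form two separated families which are orthogonal or
separated from each other. -/
structure IsSeparatedPair (B B' : Set OrientedCircle) : Prop where
  left : B.Pairwise AreSeparated
  right : B'.Pairwise AreSeparated
  cross : ∀ c ∈ B, ∀ d ∈ B', lor (normal c) (normal d) = 0 ∨ AreSeparated c d

/-- Circles of the two families that meet are orthogonal; those that do not meet have disjoint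
interiors and are therefore separated. -/
lemma IsBaseDualPair.isSeparatedPair {B B' : Set OrientedCircle} (h : IsBaseDualPair B B') :
    IsSeparatedPair B B' where
  left c hc c' hc' hne := by
    have := h.disjointInteriors hc hc' hne
    exact areSeparated_of_disjoint this.2 this.1
  right c hc c' hc' hne := by
    have := h.disjointInteriors' hc hc' hne
    exact areSeparated_of_disjoint this.2 this.1
  cross c hc d hd := by
    by_cases hn : (c.curve ∩ d.curve).Nonempty
    · obtain ⟨D, hD⟩ := h.dual
      exact Or.inl (hD ⟨c, hc⟩ ⟨d, hd⟩ hn).1.lor_eq_zero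
    · have hdis : c.IsDisjointFrom d := not_nonempty_iff_eq_empty.1 hn
      exact Or.inr (areSeparated_of_disjoint (h.disjoint_of_not_meet c hc d hd hdis)
        (Or.inl hdis))

namespace IsSeparatedPair

variable {B B' : Set OrientedCircle}

lemma symm (h : IsSeparatedPair B B') : IsSeparatedPair B' B where
  left := h.right
  right := h.left
  cross c hc d hd := (h.cross d hd c hc).imp (fun h0 => by rw [lor_comm, h0]) AreSeparated.symm

lemma lor_nonpos (h : IsSeparatedPair B B') {c d : OrientedCircle} (hc : c ∈ B) (hd : d ∈ B') :
    lor (normal c) (normal d) ≤ 0 := by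
  rcases h.cross c hc d hd with h0 | h0
  · exact h0.le
  · linarith [h0.lor_le]

lemma isRightAngled (h : IsSeparatedPair B B') : IsRightAngled (B ∪ B') := by
  rintro c (hc | hc) d (hd | hd) hne
  · exact Or.inr (h.left hc hd hne)
  · exact h.cross c hc d hd
  · exact h.symm.cross c hc d hd
  · exact Or.inr (h.right hc hd hne)

lemma isLocallyFinite (h : IsSeparatedPair B B') : IsLocallyFinite (B ∪ B') :=
  (isLocallyFinite_of_pairwise h.left).union (isLocallyFinite_of_pairwise h.right)

/-- If the sum of the normals of two circles in `B` lies on a wall in `B'`, the wall is orthogonal to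
both circles. -/
lemma lor_eq_zero_of_lor_add_eq_zero (h : IsSeparatedPair B B') {c c' d : OrientedCircle} (hc : c ∈ B)
    (hc' : c' ∈ B) (hd : d ∈ B') (h0 : lor (normal c + normal c') (normal d) = 0) :
    lor (normal c) (normal d) = 0 ∧ lor (normal c') (normal d) = 0 := by
  rw [lor_add_left] at h0
  have := h.lor_nonpos hc hd
  have := h.lor_nonpos hc' hd
  constructor <;> linarith

/-- The only walls in `B` through the sum of the normals of two circles in `B` are these two. -/
lemma eq_or_eq_of_lor_eq_zero (h : IsSeparatedPair B B') {c c' e : OrientedCircle} (hc : c ∈ B)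
    (hc' : c' ∈ B) (he : e ∈ B) (h0 : lor (normal c + normal c') (normal e) = 0) :
    e = c ∨ e = c' := by
  by_contra! hn
  have h1 := (h.left hc he hn.1.symm).lor_le
  have h2 := (h.left hc' he hn.2.symm).lor_le
  rw [lor_add_left] at h0
  linarith

/-- The sum of two normals in `B` and that of two normals in `B'` are causal and satisfy all wall
inequalities weakly. If their total is timelike, it is a point of the closed chamber and can be
pushed inside. Otherwise both are null and proportional: the two pairs are tangent at the same ideal
point and bound a rectangular cusp. A point far out in the middle of this cusp lies in the chamber.
-/
theorem chamber_nonempty (h : IsSeparatedPair B B') (hn : B.Nontrivial) (hn' : B'.Nontrivial) :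
    (chamber (B ∪ B')).Nonempty := by
  have hE := h.isRightAngled
  have hf := h.isLocallyFinite
  obtain ⟨c, hc, c', hc', hcc⟩ := hn
  obtain ⟨d, hd, d', hd', hdd⟩ := hn'
  have s1 := h.left hc hc' hcc
  have s2 := h.right hd hd' hdd
  have n1 : ∀ e ∈ B ∪ B', lor (normal c + normal c') (normal e) ≤ 0 := fun e he =>
    hE.lor_add_nonpos (Or.inl hc) (Or.inl hc') s1 he
  have n2 : ∀ e ∈ B ∪ B', lor (normal d + normal d') (normal e) ≤ 0 := fun e he =>
    hE.lor_add_nonpos (Or.inr hd) (Or.inr hd') s2 he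
  by_cases ht : IsTimelike (normal c + normal c' + (normal d + normal d'))
  · refine chamber_nonempty_of_closedChamber hE hf ⟨ht, fun e he => ?_⟩
    rw [lor_add_left]
    linarith [n1 e he, n2 e he]
  obtain ⟨k, hk, hkn⟩ := s1.1.exists_eq_smul s2.1 s1.2 s2.2 ht
  have hscale : ∀ x, lor (normal d + normal d') x = k * lor (normal c + normal c') x := fun x => by
    rw [hkn, lor_smul_left]
  have z1 : lor (normal c + normal c') (normal c + normal c') = 0 :=
    s1.1.lor_self_eq_zero fun h => ht (h.add_isCausal s2.1)
  have z2 : lor (normal d + normal d') (normal d + normal d') = 0 :=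
    s2.1.lor_self_eq_zero fun h => ht (by rw [add_comm]; exact h.add_isCausal s1.1)
  have b1 : lor (normal c) (normal c') = -1 := by
    simp only [lor_add_left, lor_add_right, lor_normal_self, lor_comm (normal c') (normal c)] at z1
    linarith
  have b2 : lor (normal d) (normal d') = -1 := by
    simp only [lor_add_left, lor_add_right, lor_normal_self, lor_comm (normal d') (normal d)] at z2
    linarith
  have b1' : lor (normal c') (normal c) = -1 := by rw [lor_comm, b1]
  have b2' : lor (normal d') (normal d) = -1 := by rw [lor_comm, b2]
  have zd : ∀ e, lor (normal d + normal d') (normal e) = 0 →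
      lor (normal c + normal c') (normal e) = 0 := fun e he =>
    (mul_eq_zero.1 ((hscale _).symm.trans he)).resolve_left hk.ne'
  obtain ⟨o1, o2⟩ := h.lor_eq_zero_of_lor_add_eq_zero hc hc' hd
    (zd d (by rw [lor_add_left, lor_normal_self, b2']; ring))
  obtain ⟨o3, -⟩ := h.lor_eq_zero_of_lor_add_eq_zero hc hc' hd'
    (zd d' (by rw [lor_add_left, lor_normal_self, b2]; ring))
  have k1 : lor (0, 1) (normal c) + lor (0, 1) (normal c') < 0 := by
    rw [← lor_add_right, lor_comm]
    exact s1.1.lor_neg s1.2 isTimelike_zero_one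
  have k2 : lor (0, 1) (normal d) + lor (0, 1) (normal d') < 0 := by
    rw [← lor_add_right, lor_comm]
    exact s2.1.lor_neg s2.2 isTimelike_zero_one
  -- The coefficients make `t` have equal products with the two normals of each pair. The common
  -- value is half of a negative sum.
  set μ := (lor (0, 1) (normal c) - lor (0, 1) (normal c')) / 2 with hμ
  set ν := (lor (0, 1) (normal d) - lor (0, 1) (normal d')) / 2 with hν
  set t : Minkowski := (0, 1) - μ • normal c - ν • normal d with ht
  have tl : ∀ x, lor t x = lor (0, 1) x - μ * lor (normal c) x - ν * lor (normal d) x := fun x => by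
    rw [ht, lor_sub_left, lor_sub_left, lor_smul_left, lor_smul_left]
  have tc : lor t (normal c) < 0 := by
    rw [tl, lor_normal_self, lor_comm (normal d), o1]; linarith
  have tc' : lor t (normal c') < 0 := by
    rw [tl, b1, lor_comm (normal d), o2]; linarith
  have td : lor t (normal d) < 0 := by
    rw [tl, lor_normal_self, o1]; linarith
  have td' : lor t (normal d') < 0 := by
    rw [tl, b2, o3]; linarith
  have hK : lor t (normal c + normal c') < 0 := by rw [lor_add_right]; linarith
  refine chamber_nonempty_of_isTimelike_add_smul hf (t := t) s1.1 n1 ?_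
    -- With this `N` the square of `t + N • n`, for `n = normal c + normal c'`, is `lor t t - 2 *
    -- (|lor t t| + 1) < 0`.
    (N := (|lor t t| + 1) / -lor t (normal c + normal c')) ?_
  · rintro e (he | he) h0
    · rcases h.eq_or_eq_of_lor_eq_zero hc hc' he h0 with rfl | rfl
      exacts [tc, tc']
    · rcases h.symm.eq_or_eq_of_lor_eq_zero hd hd' he (by rw [hscale, h0, mul_zero]) with rfl | rfl
      exacts [td, td']
  · refine isTimelike_of_lor_neg (y := normal c + normal c') ?_ s1.1 ?_
    · set N := (|lor t t| + 1) / -lor t (normal c + normal c') with hN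
      have hN' : N * lor t (normal c + normal c') = -(|lor t t| + 1) := by
        rw [hN]
        have := hK.ne
        field_simp
      rw [lor_add_left, lor_smul_left, lor_add_right t (N • _) t, lor_smul_right,
        lor_add_right t (N • _) (normal c + normal c'), lor_smul_right, z1, mul_zero, add_zero,
        lor_comm (normal c + normal c') t, hN']
      linarith [le_abs_self (lor t t), abs_nonneg (lor t t)]
    · rw [lor_add_left, lor_smul_left, z1, mul_zero, add_zero]
      exact hK

end IsSeparatedPair

/-! ### The symmetry group of the superpacking -/

lemma supergroup_eq (B B' : Set OrientedCircle) : supergroup B B' = reflectionGroup (B ∪ B') := by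
  rw [supergroup, reflectionGroup, reflectionGroup, reflectionGroup, image_union,
    Subgroup.closure_union, sup_comm]

lemma smul_mem_of_smul_eq {F : Set OrientedCircle} {f : Moebius} (h : f • F = F)
    {c : OrientedCircle} (hc : c ∈ F) : f • c ∈ F := by
  rw [← h]
  exact smul_mem_smul_set hc

lemma inv_smul_eq_of_smul_eq {F : Set OrientedCircle} {f : Moebius} (h : f • F = F) :
    f⁻¹ • F = F := by
  rw [inv_smul_eq_iff, h]

lemma smul_eq_of_forall_mem {F : Set OrientedCircle} {f : Moebius} (h : ∀ c ∈ F, f • c ∈ F)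
    (h' : ∀ c ∈ F, f⁻¹ • c ∈ F) : f • F = F := by
  refine Subset.antisymm ?_ fun c hc => Set.mem_smul_set_iff_inv_smul_mem.2 (h' c hc)
  rintro _ ⟨c, hc, rfl⟩
  exact h c hc

lemma subset_orbitOf (W : Subgroup Moebius) (F : Set OrientedCircle) : F ⊆ orbitOf W F :=
  fun c hc => ⟨1, one_mem _, c, hc, (one_smul _ c).symm⟩

lemma orbitOf_union (W : Subgroup Moebius) (F F' : Set OrientedCircle) :
    orbitOf W (F ∪ F') = orbitOf W F ∪ orbitOf W F' := by
  ext c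
  constructor
  · rintro ⟨w, hw, s, hs | hs, rfl⟩
    exacts [Or.inl ⟨w, hw, s, hs, rfl⟩, Or.inr ⟨w, hw, s, hs, rfl⟩]
  · rintro (⟨w, hw, s, hs, rfl⟩ | ⟨w, hw, s, hs, rfl⟩)
    exacts [⟨w, hw, s, Or.inl hs, rfl⟩, ⟨w, hw, s, Or.inr hs, rfl⟩]

lemma smul_orbitOf_eq {W : Subgroup Moebius} (F : Set OrientedCircle) {w : Moebius} (hw : w ∈ W) :
    w • orbitOf W F = orbitOf W F := by
  refine smul_eq_of_forall_mem ?_ ?_ <;> rintro _ ⟨v, hv, s, hs, rfl⟩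
  · exact ⟨w * v, mul_mem hw hv, s, hs, by rw [mul_smul]⟩
  · exact ⟨w⁻¹ * v, mul_mem (inv_mem hw) hv, s, hs, by rw [mul_smul]⟩

/-- Conjugating a generator by `f` gives the reflection across the image circle, which is again a
generator. -/
lemma conj_mem_reflectionGroup {E : Set OrientedCircle} {f w : Moebius}
    (hf : ∀ c ∈ E, f • c ∈ E) (hw : w ∈ reflectionGroup E) : f * w * f⁻¹ ∈ reflectionGroup E := by
  have : reflectionGroup E ≤ (reflectionGroup E).comap (MulAut.conj f).toMonoidHom := by
    refine (Subgroup.closure_le _).2 ?_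
    rintro _ ⟨c, hc, rfl⟩
    change f * reflection c * f⁻¹ ∈ reflectionGroup E
    rw [mul_reflection_mul_inv]
    exact reflection_mem_reflectionGroup (hf c hc)
  exact this hw

lemma smul_mem_union {B B' : Set OrientedCircle} {f : Moebius} (hf : f ∈ symmetryGroup B B')
    {c : OrientedCircle} (hc : c ∈ B ∪ B') : f • c ∈ B ∪ B' :=
  hc.imp (smul_mem_of_smul_eq hf.1) (smul_mem_of_smul_eq hf.2)

lemma conj_mem_supergroup {B B' : Set OrientedCircle} {f w : Moebius}
    (hf : f ∈ symmetryGroup B B') (hw : w ∈ supergroup B B') :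
    f * w * f⁻¹ ∈ supergroup B B' := by
  rw [supergroup_eq] at hw ⊢
  exact conj_mem_reflectionGroup (fun c => smul_mem_union hf) hw

lemma symmetryGroup_le_normalizer (B B' : Set OrientedCircle) :
    symmetryGroup B B' ≤ Subgroup.normalizer (supergroup B B' : Set Moebius) := by
  intro f hf
  rw [Subgroup.mem_normalizer_iff]
  refine fun w => ⟨conj_mem_supergroup hf, fun hw => ?_⟩
  have := conj_mem_supergroup (inv_mem hf) hw
  rwa [inv_inv, mul_assoc, mul_assoc, mul_assoc, inv_mul_cancel, mul_one,
    inv_mul_cancel_left] at this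

lemma supergroup_le_symmetryGroup (B B' : Set OrientedCircle) :
    supergroup B B' ≤ symmetryGroup (superpacking B B') (dualSuperpacking B B') :=
  fun _ hw => ⟨smul_orbitOf_eq B hw, smul_orbitOf_eq B' hw⟩

lemma symmetryGroup_le_symmetryGroup_superpacking (B B' : Set OrientedCircle) :
    symmetryGroup B B' ≤ symmetryGroup (superpacking B B') (dualSuperpacking B B') := by
  have key : ∀ F : Set OrientedCircle, ∀ f ∈ symmetryGroup B B', f • F = F →
      ∀ c ∈ orbitOf (supergroup B B') F, f • c ∈ orbitOf (supergroup B B') F := by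
    rintro F f hf hF _ ⟨w, hw, s, hs, rfl⟩
    refine ⟨f * w * f⁻¹, conj_mem_supergroup hf hw, f • s, smul_mem_of_smul_eq hF hs, ?_⟩
    simp only [mul_smul, inv_smul_smul]
  intro f hf
  exact ⟨smul_eq_of_forall_mem (key B f hf hf.1)
      (key B f⁻¹ (inv_mem hf) (inv_smul_eq_of_smul_eq hf.1)),
    smul_eq_of_forall_mem (key B' f hf hf.2)
      (key B' f⁻¹ (inv_mem hf) (inv_smul_eq_of_smul_eq hf.2))⟩

lemma IsSeparatedPair.eq_one_of_mem {B B' : Set OrientedCircle} (h : IsSeparatedPair B B')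
    (hne : (chamber (B ∪ B')).Nonempty) {w : Moebius} (hw : w ∈ supergroup B B')
    (hw' : w ∈ symmetryGroup B B') : w = 1 :=
  eq_one_of_forall_inv_smul_mem h.isRightAngled hne (supergroup_eq B B' ▸ hw)
    fun _ hc => smul_mem_union (inv_mem hw') hc

/-- A symmetry of the superpackings is the product of an element of the supergroup and a symmetry
of the base configuration and its dual. -/
theorem IsSeparatedPair.exists_mul_mem_symmetryGroup {B B' : Set OrientedCircle}
    (h : IsSeparatedPair B B') (hne : (chamber (B ∪ B')).Nonempty) {γ : Moebius}
    (hγ : γ ∈ symmetryGroup (superpacking B B') (dualSuperpacking B B')) :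
    ∃ w ∈ supergroup B B', w * γ ∈ symmetryGroup B B' := by
  have hE := h.isRightAngled
  have hf := h.isLocallyFinite
  obtain ⟨p, hp⟩ := hne
  obtain ⟨y, hy, -, hyp⟩ := exists_isTimelike_lor_normal_smul γ hp.1
  -- The point `y` is the image of `p` under `γ`, and `w` brings it back into the closed chamber.
  obtain ⟨w, hw, x, hx, hxy⟩ := exists_mem_closedChamber hE hf hp hy
  rw [← supergroup_eq] at hw
  refine ⟨w, hw, ?_⟩
  have hg : w * γ ∈ symmetryGroup (superpacking B B') (dualSuperpacking B B') :=
    mul_mem (supergroup_le_symmetryGroup B B' hw) hγ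
  set g := w * γ with hgdef
  have hpx : ∀ c, lor x (normal (g • c)) = lor p (normal c) := fun c => by
    rw [hgdef, mul_smul, hxy, hyp]
  have horb : ∀ f ∈ symmetryGroup (superpacking B B') (dualSuperpacking B B'),
      ∀ c ∈ orbitOf (reflectionGroup (B ∪ B')) (B ∪ B'),
        f • c ∈ orbitOf (reflectionGroup (B ∪ B')) (B ∪ B') := by
    intro f hf' c hc
    rw [← supergroup_eq, orbitOf_union] at hc ⊢
    exact smul_mem_union hf' hc
  have hxC : x ∈ chamber (B ∪ B') :=
    mem_chamber_of_lor_eq hE (horb _ (inv_mem hg)) hp hx hpx hp hx.1 hpx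
  have h1 : ∀ c ∈ B ∪ B', g • c ∈ B ∪ B' := fun c hc =>
    smul_mem_of_lor_eq hE hf (horb g hg) (horb _ (inv_mem hg)) hp hx hpx hc
  have h2 : ∀ c ∈ B ∪ B', g⁻¹ • c ∈ B ∪ B' := fun c hc =>
    smul_mem_of_lor_eq hE hf (horb _ (inv_mem hg)) (by rw [inv_inv]; exact horb g hg) hxC
      ⟨hp.1, fun c hc => (hp.2 c hc).le⟩ (fun c => by rw [← hpx, smul_inv_smul]) hc
  -- Distinct circles of `B ∪ B'` lie in different orbits, so the orbit of `F` meets `B ∪ B'` only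
  -- in `F`. This keeps `B` and `B'` apart.
  have h3 : ∀ F ⊆ B ∪ B', ∀ c ∈ B ∪ B', c ∈ orbitOf (supergroup B B') F → c ∈ F := by
    rintro F hF c hc ⟨v, hv, s, hs, hcs⟩
    rw [supergroup_eq] at hv
    rw [← eq_of_smul_eq hE ⟨p, hp⟩ hv (hF hs) hc hcs.symm]
    exact hs
  have h4 : ∀ F ⊆ B ∪ B', g • orbitOf (supergroup B B') F = orbitOf (supergroup B B') F →
      g • F = F := by
    intro F hF hgF
    refine smul_eq_of_forall_mem (fun c hc => ?_) fun c hc => ?_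
    · exact h3 F hF _ (h1 c (hF hc)) (smul_mem_of_smul_eq hgF (subset_orbitOf _ F hc))
    · exact h3 F hF _ (h2 c (hF hc))
        (smul_mem_of_smul_eq (inv_smul_eq_of_smul_eq hgF) (subset_orbitOf _ F hc))
  exact ⟨h4 B subset_union_left hg.1, h4 B' subset_union_right hg.2⟩

end CirclePacking

end

/-! ### The semidirect product decomposition. -/

theorem mainTheorem11 (B B' : Set CirclePacking.OrientedCircle)
    (hB : CirclePacking.IsBaseDualPair B B') :
    ∃ φ : CirclePacking.symmetryGroup B B' →* MulAut (CirclePacking.supergroup B B'),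
      (∀ (h : CirclePacking.symmetryGroup B B') (n : CirclePacking.supergroup B B'),
        ((φ h n : CirclePacking.supergroup B B') : CirclePacking.Moebius) =
          (h : CirclePacking.Moebius) * (n : CirclePacking.Moebius) *
            (h : CirclePacking.Moebius)⁻¹) ∧
      ∃ e : CirclePacking.supergroup B B' ⋊[φ] CirclePacking.symmetryGroup B B' ≃*
          CirclePacking.symmetryGroup (CirclePacking.superpacking B B')
            (CirclePacking.dualSuperpacking B B'),
        ∀ x, (e x : CirclePacking.Moebius) =
          (x.left : CirclePacking.Moebius) * (x.right : CirclePacking.Moebius) := by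
  open CirclePacking in
  have h := hB.isSeparatedPair
  have hne := h.chamber_nonempty hB.nontrivial hB.nontrivial'
  let φ : symmetryGroup B B' →* MulAut (supergroup B B') :=
    (Subgroup.normalizerMonoidHom (supergroup B B')).comp
      (Subgroup.inclusion (symmetryGroup_le_normalizer B B'))
  have hφ : ∀ (f : symmetryGroup B B') (n : supergroup B B'),
      ((φ f n : supergroup B B') : Moebius) = (f : Moebius) * (n : Moebius) * (f : Moebius)⁻¹ :=
    fun _ _ => rfl
  let m : supergroup B B' ⋊[φ] symmetryGroup B B' →* Moebius :=
    SemidirectProduct.lift (supergroup B B').subtype (symmetryGroup B B').subtype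
      fun f => MonoidHom.ext fun n => hφ f n
  have hm : ∀ x, m x = (x.left : Moebius) * (x.right : Moebius) := fun _ => rfl
  have hmem : ∀ x, m x ∈ symmetryGroup (superpacking B B') (dualSuperpacking B B') := fun x =>
    mul_mem (supergroup_le_symmetryGroup B B' x.left.2)
      (symmetryGroup_le_symmetryGroup_superpacking B B' x.right.2)
  refine ⟨φ, hφ, MulEquiv.ofBijective (m.codRestrict _ hmem) ⟨?_, ?_⟩, fun x => hm x⟩
  · refine (injective_iff_map_eq_one _).2 fun x hx => ?_
    have hx' : (x.left : Moebius) * (x.right : Moebius) = 1 := congrArg Subtype.val hx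
    -- An element of the kernel puts `x.left` into the intersection of the two factors, which is
    -- trivial.
    have e : (x.left : Moebius) = ((x.right : Moebius))⁻¹ := eq_inv_of_mul_eq_one_left hx'
    have h1 : (x.left : Moebius) = 1 :=
      h.eq_one_of_mem hne x.left.2 (e ▸ inv_mem x.right.2)
    rw [h1, one_mul] at hx'
    exact SemidirectProduct.ext (Subtype.ext h1) (Subtype.ext hx')
  · rintro ⟨γ, hγ⟩
    obtain ⟨w, hw, hwγ⟩ := h.exists_mul_mem_symmetryGroup hne hγ
    exact ⟨⟨⟨w⁻¹, inv_mem hw⟩, ⟨w * γ, hwγ⟩⟩, Subtype.ext (inv_mul_cancel_left w γ)⟩
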